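/- **Setting.** Let $\mathcal X$ be a measurable space and let $x\mapsto p_{Y|x}$ be a measurable map (a classifier) from $\mathcal X$ to the probability vectors on $[d]=\{1,\dots,d\}$. Let $p_1,\dots,p_G$ ($G\ge 1$) be probability distributions on $\mathcal X$ (the generative models), with marginal class distributions $p_{Y_g}=\mathbb E_{X\sim p_g}[p_{Y|X}]$ and Inception scores $$\mathrm{IS}_g=\exp\big\{\mathbb E_{X\sim p_g}[\mathrm{KL}(p_{Y|X}\,\|\,p_{Y_g})]\big\}.$$ For $z\in\mathbb R_+^d$ put $\mathcal E(z)=-\sum_j z[j]\log z[j]$ (with $0\log 0=0$). For $n\ge2$ samples $x^1,\dots,x^n$ and a number $\delta'>0$, put $\ell=\log(4d/\delta')$, let $\widetilde p=\frac1n\sum_i p_{Y|x^i}$ and $\widehat H=\frac1n\sum_i\mathcal E(p_{Y|x^i})$, and let $\widehat V(z_1,\dots,z_n)=\frac1{n(n-1)}\sum_{i<j}(z_i-z_j)^2$ be the sample variance. Let $$\epsilon[j]=\sqrt{\tfrac{2}{n}\widehat V\big((p_{Y|x^i}[j])_i\big)\,\ell}+\tfrac{7}{3(n-1)}\,\ell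 ,$$ let $\widehat p[j]$ be the point obtained from $\widetilde p[j]$ by moving it by $\epsilon[j]$ towards $e^{-1}$ (but not beyond $e^{-1}$), and define the optimistic score $$\widehat{\mathrm{IS}}=\exp\Big\{\mathcal E(\widehat p)-\widehat H+\sqrt{\tfrac{2}{n}\widehat V\big((\mathcal E(p_{Y|x^i}))_i\big)\,\ell}+\tfrac{7\log d}{3(n-1)}\,\ell\Big\};$$ for $n\le 1$ put $\widehat{\mathrm{IS}}=\infty$. **Algorithm IS-UCB** (number of steps $T\ge1$, batch size $b\ge1$, failure probability $\delta\in(0,1)$). At each step $t=1,\dots,T$, pick a model $g_t$ that maximizes the optimistic score $\widehat{\mathrm{IS}}_g$, computed with $\delta'=\delta/T$ from all samples generated by model $g$ so far (ties are broken arbitrarily), and let $g_t$ generate $b$ new samples. The samples of each model are i.i.d. from its distribution, and all samples are independent. The regret is $\mathrm{Regret}(T)=\sum_{t=1}^T(\max_g\mathrm{IS}_g-\mathrm{IS}_{g_t})$. **Theorem (Regret of IS-UCB).** There are universal constants $K>0$ and $k\in\mathbb N$ and numbers $C=C(d,G)$ with $0\le C\le Kd+\frac12\log G$ (so $C=\widetilde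 O(d)$, where the hidden logarithm is that of $G$ only) such that, in the setting above, with probability at least $1-\delta$, $$\mathrm{Regret}(T)\le K\,\log^k\!\Big(\frac{4dT}{\delta}\Big)\Big(G\,\Delta^{-2}\log d+e^{C}\big((dm+\log d)\sqrt T+\log T\big)\Big),$$ where, with $u(x)=-x\log x$, $$m=\max_{g,j:\ p_{Y_g}[j]>0}|u'(p_{Y_g}[j])|,\qquad \Delta=\min_{g,j:\ p_{Y_g}[j]\ne e^{-1}}|p_{Y_g}[j]-e^{-1}| .$$ -/

import Mathlib

open MeasureTheory ProbabilityTheory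

noncomputable section

namespace ISUCB

/-! Throughout, `q x j` is the probability `p_{Y|x}[j]` that a fixed classifier assigns to the
class `j ∈ [d]` of the sample `x`, and `p` is the distribution of the samples of one model. -/

section Score

variable {𝒳 : Type*} [MeasurableSpace 𝒳] {d : ℕ}

/-- The marginal class probability `p_Y[j] = 𝔼_{X ∼ p} p_{Y|X}[j]`. -/
def marginal (q : 𝒳 → Fin d → ℝ) (p : Measure 𝒳) (j : Fin d) : ℝ :=
  ∫ x, q x j ∂p

/-- The Kullback-Leibler divergence `∑ j, r[j] log (r[j] / s[j])` of two distributions on `[d]`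
(a term with `r[j] = 0` is `0`; it is only used below where, almost surely, `s[j] = 0` implies
`r[j] = 0`). -/
def kl (r s : Fin d → ℝ) : ℝ :=
  ∑ j, r j * Real.log (r j / s j)

/-- The Inception score `exp (𝔼_{X ∼ p} KL(p_{Y|X} ‖ p_Y))`. -/
def inceptionScore (q : 𝒳 → Fin d → ℝ) (p : Measure 𝒳) : ℝ :=
  Real.exp (∫ x, kl (q x) (marginal q p) ∂p)

end Score

section Estimators

/-- `𝓔(z) = - ∑ j, z[j] log z[j]`; on probability vectors it is the Shannon entropy. -/
def entropy {d : ℕ} (z : Fin d → ℝ) : ℝ :=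
  ∑ j, Real.negMulLog (z j)

/-- The empirical mean of the first `n` terms of `z`. -/
def sampleMean (z : ℕ → ℝ) (n : ℕ) : ℝ :=
  (∑ i ∈ Finset.range n, z i) / n

/-- The sample variance `(n (n - 1))⁻¹ ∑_{i < j} (z_i - z_j)²` of the first `n` terms of `z`. -/
def sampleVar (z : ℕ → ℝ) (n : ℕ) : ℝ :=
  (∑ j ∈ Finset.range n, ∑ i ∈ Finset.range j, (z i - z j) ^ 2) / ((n : ℝ) * ((n : ℝ) - 1))

/-- The empirical Bernstein radius for `n` values in an interval of length `R`, with the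
logarithmic factor `log (4 d / δ)`. -/
def radius (d : ℕ) (δ R : ℝ) (z : ℕ → ℝ) (n : ℕ) : ℝ :=
  Real.sqrt (2 * sampleVar z n / n * Real.log (4 * d / δ))
    + 7 * R / (3 * ((n : ℝ) - 1)) * Real.log (4 * d / δ)

/-- The operator `Clip_{e⁻¹}` on one coordinate: move `p` by `ε` towards `e⁻¹`, but not beyond. -/
def clip (p ε : ℝ) : ℝ :=
  if ε ≤ |Real.exp (-1) - p| then
    p + (Real.exp (-1) - p) / |Real.exp (-1) - p| * ε
  else Real.exp (-1)

variable {𝒳 : Type*} {d : ℕ}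

/-- The optimistic marginal class distribution computed from `x 0, …, x (n - 1)`. -/
def optimisticMarginal (q : 𝒳 → Fin d → ℝ) (δ : ℝ) (x : ℕ → 𝒳) (n : ℕ) (j : Fin d) : ℝ :=
  clip (sampleMean (fun i => q (x i) j) n) (radius d δ 1 (fun i => q (x i) j) n)

/-- The optimistic Inception score computed from `x 0, …, x (n - 1)`. It is `∞` before the first
sample and for `n = 1`, where the radius (which divides by `n - 1`) is infinite. -/
def optimisticIS (q : 𝒳 → Fin d → ℝ) (δ : ℝ) (x : ℕ → 𝒳) (n : ℕ) : EReal :=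
  if n ≤ 1 then ⊤
  else ((Real.exp (entropy (optimisticMarginal q δ x n)
      - sampleMean (fun i => entropy (q (x i))) n
      + radius d δ (Real.log d) (fun i => entropy (q (x i))) n) : ℝ) : EReal)

end Estimators

section Bandit

variable {𝒳 : Type*} {d G : ℕ}

/-- The number of times that the model `g` is picked in the steps before step `t`
(steps are numbered from `0`). -/
def visits (a : ℕ → Fin G) (t : ℕ) (g : Fin G) : ℕ :=
  ((Finset.range t).filter (fun s => a s = g)).card

/-- `a 0, …, a (T - 1)` is the sequence of models picked by IS-UCB, run for `T` steps with batch
size `b` and failure probability `δ / T` in the score, when `x g 0, x g 1, …` are the successive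
samples generated by the model `g`: every pick maximizes the current optimistic score (ties are
broken arbitrarily), and every time `g` is picked it generates its next `b` samples. -/
def IsRun (q : 𝒳 → Fin d → ℝ) (δ : ℝ) (b T : ℕ) (x : Fin G → ℕ → 𝒳) (a : ℕ → Fin G) : Prop :=
  ∀ t < T, ∀ g : Fin G,
    optimisticIS q (δ / T) (x g) (b * visits a t g)
      ≤ optimisticIS q (δ / T) (x (a t)) (b * visits a t (a t))

variable [MeasurableSpace 𝒳]

/-- `Regret(T) = ∑_t (max_g IS_g - IS_{g_t})`. -/
def regret (q : 𝒳 → Fin d → ℝ) (p : Fin G → Measure 𝒳) (T : ℕ) (a : ℕ → Fin G) : ℝ :=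
  ∑ t ∈ Finset.range T,
    ((⨆ g, inceptionScore q (p g)) - inceptionScore q (p (a t)))

/-- `m`, the largest `|u'|` of `u(x) = - x log x` at the positive marginal class probabilities. -/
def slope (q : 𝒳 → Fin d → ℝ) (p : Fin G → Measure 𝒳) : ℝ :=
  sSup {r | ∃ g j, 0 < marginal q (p g) j ∧ r = |deriv Real.negMulLog (marginal q (p g) j)|}

/-- `Δ`, the smallest distance to `e⁻¹` of the marginal class probabilities other than `e⁻¹`. -/
def gap (q : 𝒳 → Fin d → ℝ) (p : Fin G → Measure 𝒳) : ℝ :=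
  sInf {r | ∃ g j, marginal q (p g) j ≠ Real.exp (-1) ∧
    r = |marginal q (p g) j - Real.exp (-1)|}

end Bandit

end ISUCB

end

/-! The proof is an optimism argument resting on an empirical Bernstein bound. Since
`inceptionScore` is the exponential of entropy of the marginal minus mean entropy, two kinds of
bounded means have to be estimated. Bernstein's inequality controls a mean in terms of its true
standard deviation. A Hoeffding-type average over permutations controls the lower tail of the sample
variance (`sampleVar_lower_tail`). Together they give `exists_bernstein_events` with the constant
7/3.

The function u(x) = -x log x increases up to e⁻¹ and decreases afterwards, so moving an ε-accurate
estimate by ε towards e⁻¹ can only overestimate u (`negMulLog_le_negMulLog_clip`). Conversely,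
concavity bounds the overshoot by a multiple of m L/√n. At a zero marginal u' is infinite, but there
all samples vanish almost surely, the radius is O(L/n), and u(x) ≤ 2√x restores the rate
(`optimistic_exponent_le`). Hence a step with v earlier visits costs O(1/√(v+1)), and Cauchy–Schwarz
over the models gives √(GT).

No log G enters L. Optimism at level L is needed only for one best model; the picked model needs
accuracy merely up to a constant, hence at level 3L, where the failure probability is cubed and pays
for a union over G ≤ T models (`failure_probability_le`). For T ≤ G the trivial regret d T is
already below d √(GT). The factor d²√G is absorbed by e^C, and the remaining summands of the bound
only need to be nonnegative. -/

noncomputable section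

namespace ISUCB

/-! ### Quadratic upper bounds of the exponential -/

section ExpBounds

/-- The quadratic lower bound of e^{-x} suffices, because (1 + x + x²/2)(1 - x + x²/2) = 1 + x⁴/4 ≥
1. -/
theorem exp_le_quadratic_of_nonpos {x : ℝ} (hx : x ≤ 0) : Real.exp x ≤ 1 + x + x ^ 2 / 2 := by
  have h := Real.quadratic_le_exp_of_nonneg (x := -x) (by linarith)
  have h1 : Real.exp x * Real.exp (-x) = 1 := by rw [← Real.exp_add]; simp
  have h2 : 0 < Real.exp x := Real.exp_pos x
  have h3 : Real.exp x * (1 + -x + (-x) ^ 2 / 2) ≤ 1 := by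
    exact (mul_le_mul_of_nonneg_left h h2.le).trans h1.le
  have h4 : 0 < 1 + -x + (-x) ^ 2 / 2 := by nlinarith [sq_nonneg x]
  have h5 : (1 : ℝ) ≤ (1 + x + x ^ 2 / 2) * (1 + -x + (-x) ^ 2 / 2) := by
    nlinarith [sq_nonneg (x ^ 2)]
  exact le_of_mul_le_mul_right (h3.trans h5) h4

/-- Since (n + 2)! ≥ 2 · 3ⁿ, the tail of the series is dominated by a geometric series of ratio x/3.
-/
theorem exp_le_quadratic_of_lt_three {x : ℝ} (hx : 0 ≤ x) (hx3 : x < 3) :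
    Real.exp x ≤ 1 + x + x ^ 2 / (2 * (1 - x / 3)) := by
  have h1 := NormedSpace.expSeries_div_hasSum_exp x
  rw [← Real.exp_eq_exp_ℝ, ← hasSum_nat_add_iff' 2] at h1
  have h2 : HasSum (fun n : ℕ => x ^ 2 / 2 * (x / 3) ^ n) (x ^ 2 / 2 * (1 - x / 3)⁻¹) :=
    (hasSum_geometric_of_lt_one (by positivity) (by linarith)).mul_left _
  have h3 := hasSum_le (fun n => ?_) h1 h2
  · simp only [Finset.sum_range_succ, Finset.sum_range_zero] at h3
    have h4 : x ^ 2 / 2 * (1 - x / 3)⁻¹ = x ^ 2 / (2 * (1 - x / 3)) := by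
      rw [← div_eq_mul_inv, div_div]
    norm_num at h3
    rw [h4] at h3
    linarith
  · have h5 : ((2 * 3 ^ n : ℕ) : ℝ) ≤ ((n + 2).factorial : ℕ) := by
      have := Nat.factorial_mul_pow_le_factorial (m := 2) (n := n)
      norm_num [Nat.add_comm] at this ⊢
      exact_mod_cast this
    push_cast at h5
    have : x ^ 2 / 2 * (x / 3) ^ n = x ^ (n + 2) / (2 * 3 ^ n) := by
      rw [div_pow, pow_add]; field_simp
    rw [this]
    gcongr

theorem exp_le_quadratic {x s : ℝ} (hxs : x ≤ s) (hs0 : 0 ≤ s) (hs : s < 3) :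
    Real.exp x ≤ 1 + x + x ^ 2 / (2 * (1 - s / 3)) := by
  rcases le_total x 0 with hx | hx
  · refine (exp_le_quadratic_of_nonpos hx).trans ?_
    have : 0 < 2 * (1 - s / 3) := by linarith
    gcongr
    linarith
  · refine (exp_le_quadratic_of_lt_three hx (by linarith)).trans ?_
    have : 0 < 2 * (1 - s / 3) := by linarith
    gcongr

end ExpBounds

/-! ### Bernstein's inequality -/

section Bernstein

variable {Ω : Type*} [MeasurableSpace Ω] {μ : Measure Ω} [IsProbabilityMeasure μ]

theorem integrable_of_mem_Icc {X : Ω → ℝ} (hX : Measurable X) {a b : ℝ}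
    (h : ∀ ω, X ω ∈ Set.Icc a b) : Integrable X μ :=
  Integrable.of_mem_Icc a b hX.aemeasurable (ae_of_all _ h)

theorem memLp_of_mem_Icc {X : Ω → ℝ} (hX : Measurable X) {a b : ℝ}
    (h : ∀ ω, X ω ∈ Set.Icc a b) (p : ENNReal) : MemLp X p μ :=
  memLp_of_bounded (ae_of_all _ h) hX.aestronglyMeasurable p

/-- Bernstein's bound of the moment generating function of a variable with values in `[0, 1]`. -/
theorem mgf_centered_le {X : Ω → ℝ} (hX : Measurable X) (h01 : ∀ ω, X ω ∈ Set.Icc (0 : ℝ) 1)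
    {s : ℝ} (hs0 : 0 ≤ s) (hs : s < 3) :
    mgf (fun ω => X ω - ∫ ω, X ω ∂μ) μ s
      ≤ Real.exp (s ^ 2 * Var[X; μ] / (2 * (1 - s / 3))) := by
  set M := ∫ ω, X ω ∂μ with hM
  have hint : Integrable X μ := integrable_of_mem_Icc hX h01
  have hM0 : 0 ≤ M := integral_nonneg fun ω => (h01 ω).1
  have hsq : Integrable (fun ω => (X ω - M) ^ 2) μ :=
    ((memLp_of_mem_Icc hX h01 2).sub (memLp_const M)).integrable_sq
  have hpos : 0 < 2 * (1 - s / 3) := by linarith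
  have hdiff : Integrable (fun ω => s * (X ω - M)) μ :=
    (hint.sub (integrable_const M)).const_mul s
  have hlin : Integrable (fun ω => 1 + s * (X ω - M)) μ := (integrable_const 1).add hdiff
  have hq : Integrable (fun ω => s ^ 2 * (X ω - M) ^ 2 / (2 * (1 - s / 3))) μ :=
    (hsq.const_mul _).div_const _
  calc mgf (fun ω => X ω - M) μ s
      ≤ ∫ ω, (1 + s * (X ω - M) + s ^ 2 * (X ω - M) ^ 2 / (2 * (1 - s / 3))) ∂μ := by
        refine integral_mono_of_nonneg (ae_of_all _ fun ω => (Real.exp_pos _).le)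
          (hlin.add hq) (ae_of_all _ fun ω => ?_)
        have h1 : s * (X ω - M) ≤ s := by nlinarith [(h01 ω).2]
        have := exp_le_quadratic h1 hs0 hs
        rwa [mul_pow] at this
    _ = 1 + s ^ 2 * Var[X; μ] / (2 * (1 - s / 3)) := by
        rw [integral_add hlin hq, integral_add (integrable_const 1) hdiff, integral_const_mul,
          integral_sub hint (integrable_const _), integral_div, integral_const_mul,
          variance_eq_integral hX.aemeasurable]
        simp [← hM]
    _ ≤ _ := by
        have := Real.add_one_le_exp (s ^ 2 * Var[X; μ] / (2 * (1 - s / 3)))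
        linarith

/-- **Bernstein's inequality**. -/
theorem bernstein_sum {Z : ℕ → Ω → ℝ} (hZ : ∀ i, Measurable (Z i))
    (h01 : ∀ i ω, Z i ω ∈ Set.Icc (0 : ℝ) 1) (hind : iIndepFun Z μ) {M V : ℝ}
    (hM : ∀ i, ∫ ω, Z i ω ∂μ = M) (hV : ∀ i, Var[Z i; μ] = V) (n : ℕ) (hn : 0 < n) {L : ℝ}
    (hL : 0 < L) :
    μ.real {ω | Real.sqrt (2 * (n * V) * L) + L / 3 ≤ ∑ i ∈ Finset.range n, (Z i ω - M)}
      ≤ Real.exp (-L) := by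
  have hn' : (0 : ℝ) < n := by exact_mod_cast hn
  have hV0 : 0 ≤ V := hV 0 ▸ variance_nonneg _ _
  -- The tuning below divides by V. If V = 0 the variables are almost surely constant and the event
  -- is null because L > 0.
  rcases hV0.eq_or_lt with h0 | hVpos
  · have hae : ∀ᵐ ω ∂μ, ∀ i, Z i ω = M := by
      rw [ae_all_iff]
      intro i
      have := ae_eq_integral_of_variance_eq_zero (memLp_of_mem_Icc (μ := μ) (hZ i) (h01 i) 2)
        (by rw [hV i, h0])
      filter_upwards [this] with ω hω
      rw [hω, hM i]
    have : μ {ω | Real.sqrt (2 * (n * V) * L) + L / 3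
        ≤ ∑ i ∈ Finset.range n, (Z i ω - M)} = 0 := by
      rw [measure_eq_zero_iff_ae_notMem]
      filter_upwards [hae] with ω hω
      simp only [hω, sub_self, Finset.sum_const_zero, not_le]
      positivity
    rw [measureReal_def, this]
    simp [(Real.exp_pos _).le]
  set v : ℝ := n * V with hv
  have hvpos : 0 < v := by positivity
  set r : ℝ := Real.sqrt (2 * L / v) with hr
  have hrpos : 0 < r := Real.sqrt_pos.2 (by positivity)
  have hr2 : v * r ^ 2 = 2 * L := by
    rw [hr, Real.sq_sqrt (by positivity)]; field_simp
  have hsq : Real.sqrt (2 * v * L) = v * r := by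
    rw [Real.sqrt_eq_iff_mul_self_eq (by positivity) (by positivity)]
    nlinarith
  -- This choice gives 1 - s/3 = 1/(1 + r/3), and with v r² = 2L the Chernoff exponent is exactly
  -- -L.
  set s : ℝ := r / (1 + r / 3) with hs
  have hspos : 0 < s := by positivity
  have hs3 : s < 3 := by
    rw [hs, div_lt_iff₀ (by positivity)]; linarith
  have hmeas : ∀ i, Measurable (fun ω => Z i ω - M) := fun i => (hZ i).sub_const M
  have hind' : iIndepFun (fun i ω => Z i ω - M) μ :=
    hind.comp (fun _ x => x - M) fun _ => measurable_id.sub_const M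
  have hmgf := hind'.mgf_sum hmeas (Finset.range n) (t := s)
  have hsum_eq : (∑ i ∈ Finset.range n, fun ω => Z i ω - M)
      = fun ω => ∑ i ∈ Finset.range n, (Z i ω - M) := by
    ext ω; simp
  rw [hsum_eq] at hmgf
  have hM01 : 0 ≤ M ∧ M ≤ 1 := by
    rw [← hM 0]
    refine ⟨integral_nonneg fun ω => (h01 0 ω).1, ?_⟩
    calc ∫ ω, Z 0 ω ∂μ ≤ ∫ _, (1 : ℝ) ∂μ :=
          integral_mono (integrable_of_mem_Icc (hZ 0) (h01 0)) (integrable_const _)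
            fun ω => (h01 0 ω).2
      _ = 1 := by simp
  have hint : Integrable (fun ω => Real.exp (s * ∑ i ∈ Finset.range n, (Z i ω - M))) μ := by
    refine integrable_of_mem_Icc (a := 0) (b := Real.exp (s * n)) ?_ fun ω =>
      ⟨(Real.exp_pos _).le, ?_⟩
    · exact ((Finset.measurable_sum _ fun i _ => hmeas i).const_mul s).exp
    · gcongr
      calc ∑ i ∈ Finset.range n, (Z i ω - M) ≤ ∑ i ∈ Finset.range n, (1 : ℝ) := by
            gcongr with i; linarith [(h01 i ω).2]
        _ = n := by simp
  have hch := measure_ge_le_exp_mul_mgf (Real.sqrt (2 * v * L) + L / 3) hspos.le hint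
  refine hch.trans ?_
  rw [hmgf]
  calc _ ≤ Real.exp (-s * (Real.sqrt (2 * v * L) + L / 3)) *
        ∏ i ∈ Finset.range n, Real.exp (s ^ 2 * V / (2 * (1 - s / 3))) := by
        gcongr with i
        · intro i _; exact mgf_nonneg
        · have := mgf_centered_le (μ := μ) (hZ i) (h01 i) hspos.le hs3
          rwa [hV i, hM i] at this
    _ = Real.exp (-L) := by
        rw [Finset.prod_const, Finset.card_range, ← Real.exp_nat_mul, ← Real.exp_add, hsq]
        congr 1
        have h1 : 1 - s / 3 = 1 / (1 + r / 3) := by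
          rw [hs]; field_simp; ring
        have h2 : (n : ℝ) * (s ^ 2 * V / (2 * (1 - s / 3))) = L / (1 + r / 3) := by
          rw [h1, hs]
          have : (n : ℝ) * V = 2 * L / r ^ 2 := by
            rw [← hr2, ← hv]; field_simp
          have h3 : V = 2 * L / r ^ 2 / n := by rw [← this]; field_simp
          rw [h3]; field_simp
        have h4 : v * r = 2 * L / r := by rw [← hr2]; field_simp
        rw [h2, h4, hs]
        field_simp
        ring

end Bernstein

/-! ### The sample variance as an average over permutations -/

section PermutationAverage

/-- The sum over all permutations of the value of a kernel at two fixed distinct places. -/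
theorem sum_perm_apply_pair {n : ℕ} (f : Fin n → Fin n → ℝ) {a b : Fin n} (hab : a ≠ b) :
    (n : ℝ) * (n - 1) * ∑ σ : Equiv.Perm (Fin n), f (σ a) (σ b)
      = (Fintype.card (Equiv.Perm (Fin n)) : ℝ) * ∑ i, ∑ j, if i = j then 0 else f i j := by
  have hinv : ∀ i j : Fin n, i ≠ j →
      ∑ σ : Equiv.Perm (Fin n), f (σ i) (σ j) = ∑ σ : Equiv.Perm (Fin n), f (σ a) (σ b) := by
    intro i j hij
    -- The first swap sends a to i; the second sends the image of b to j and fixes i. Right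
    -- multiplication by τ then shows that the sum is the same for every pair.
    obtain ⟨τ, hτa, hτb⟩ : ∃ τ : Equiv.Perm (Fin n), τ a = i ∧ τ b = j := by
      refine ⟨(Equiv.swap a i).trans (Equiv.swap (Equiv.swap a i b) j), ?_, ?_⟩
      · simp only [Equiv.trans_apply, Equiv.swap_apply_left]
        refine Equiv.swap_apply_of_ne_of_ne (fun h => hab ?_) hij
        have : Equiv.swap a i a = Equiv.swap a i b := by rw [Equiv.swap_apply_left]; exact h
        exact (Equiv.swap a i).injective this
      · simp
    refine (Fintype.sum_equiv (Equiv.mulRight τ) _ _ fun σ => ?_)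
    simp [hτa, hτb]
  have h1 : ∑ i : Fin n, ∑ j : Fin n, (if i = j then (0 : ℝ)
      else ∑ σ : Equiv.Perm (Fin n), f (σ i) (σ j))
      = (n : ℝ) * (n - 1) * ∑ σ : Equiv.Perm (Fin n), f (σ a) (σ b) := by
    calc _ = ∑ i : Fin n, ∑ j : Fin n, (∑ σ : Equiv.Perm (Fin n), f (σ a) (σ b)
          - if i = j then (∑ σ : Equiv.Perm (Fin n), f (σ a) (σ b)) else 0) := by
          refine Finset.sum_congr rfl fun i _ => Finset.sum_congr rfl fun j _ => ?_
          split_ifs with h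
          · simp
          · simp [hinv i j h]
      _ = _ := by
          simp only [Finset.sum_sub_distrib, Finset.sum_ite_eq, Finset.mem_univ, if_true,
            Finset.sum_const, Finset.card_univ, Fintype.card_fin, nsmul_eq_mul]
          ring
  rw [← h1]
  have h2 : ∀ i j : Fin n, (if i = j then (0 : ℝ)
      else ∑ σ : Equiv.Perm (Fin n), f (σ i) (σ j))
      = ∑ σ : Equiv.Perm (Fin n), (fun i j => if i = j then 0 else f i j) (σ i) (σ j) := by
    intro i j
    split_ifs with h
    · simp [h]
    · refine Finset.sum_congr rfl fun σ _ => ?_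
      simp [h]
  have h3 : ∀ σ : Equiv.Perm (Fin n),
      ∑ i, ∑ j, (fun i j => if i = j then 0 else f i j) (σ i) (σ j)
        = ∑ i, ∑ j, if i = j then 0 else f i j := by
    intro σ
    rw [Equiv.sum_comp σ (fun i => ∑ j, (fun i j => if i = j then 0 else f i j) i (σ j))]
    refine Finset.sum_congr rfl fun i _ => ?_
    exact Equiv.sum_comp σ (fun j => if i = j then 0 else f i j)
  simp only [h2]
  rw [Finset.sum_congr rfl fun i _ => Finset.sum_comm, Finset.sum_comm]
  rw [Finset.sum_congr rfl fun σ _ => h3 σ]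
  simp [Finset.card_univ]

theorem sum_range_sum_range_lt (f : ℕ → ℕ → ℝ) (hf : ∀ i j, f i j = f j i) (n : ℕ) :
    2 * ∑ j ∈ Finset.range n, ∑ i ∈ Finset.range j, f i j
      = ∑ i ∈ Finset.range n, ∑ j ∈ Finset.range n, if i = j then 0 else f i j := by
  induction n with
  | zero => simp
  | succ n ih =>
    rw [Finset.sum_range_succ, mul_add, ih, Finset.sum_range_succ (n := n)]
    have h1 : ∀ i ∈ Finset.range n, (∑ j ∈ Finset.range (n + 1), if i = j then 0 else f i j)
        = (∑ j ∈ Finset.range n, if i = j then 0 else f i j) + f i n := by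
      intro i hi
      rw [Finset.sum_range_succ, if_neg (Finset.mem_range.1 hi).ne]
    rw [Finset.sum_congr rfl h1, Finset.sum_add_distrib, Finset.sum_range_succ, if_pos rfl]
    have h2 : ∀ j ∈ Finset.range n, (if n = j then 0 else f n j) = f j n := by
      intro j hj
      rw [if_neg (Finset.mem_range.1 hj).ne', hf]
    rw [Finset.sum_congr rfl h2]
    ring

theorem two_mul_sum_sq_eq (z : ℕ → ℝ) (n : ℕ) :
    2 * ∑ j ∈ Finset.range n, ∑ i ∈ Finset.range j, (z i - z j) ^ 2
      = ∑ i : Fin n, ∑ j : Fin n, if i = j then 0 else (z i - z j) ^ 2 := by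
  rw [sum_range_sum_range_lt (fun i j => (z i - z j) ^ 2) (fun i j => by ring), Finset.sum_range]
  refine Finset.sum_congr rfl fun i _ => ?_
  rw [Finset.sum_range]
  simp [Fin.ext_iff]

/-- The sample variance as an average over permutations of sums over disjoint pairs. -/
theorem sampleVar_eq_average (z : ℕ → ℝ) {n N : ℕ} (hn : 2 ≤ n) (hN : 2 * N ≤ n) :
    (N : ℝ) * sampleVar z n = ∑ σ : Equiv.Perm (Fin n),
      (Fintype.card (Equiv.Perm (Fin n)) : ℝ)⁻¹ * ∑ k : Fin N,
        (z (σ ⟨2 * k, by omega⟩) - z (σ ⟨2 * k + 1, by omega⟩)) ^ 2 / 2 := by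
  have hcard : (Fintype.card (Equiv.Perm (Fin n)) : ℝ) ≠ 0 := by
    exact_mod_cast Fintype.card_ne_zero
  have hn0 : (n : ℝ) ≠ 0 := by positivity
  have hn1 : (n : ℝ) - 1 ≠ 0 := by
    have : (2 : ℝ) ≤ n := by exact_mod_cast hn
    linarith
  have key : ∀ k : Fin N, ∑ σ : Equiv.Perm (Fin n),
      (z (σ ⟨2 * k, by omega⟩) - z (σ ⟨2 * k + 1, by omega⟩)) ^ 2 / 2
        = (Fintype.card (Equiv.Perm (Fin n)) : ℝ) * sampleVar z n := by
    intro k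
    have h := sum_perm_apply_pair (fun i j : Fin n => (z i - z j) ^ 2)
      (a := ⟨2 * k, by omega⟩) (b := ⟨2 * k + 1, by omega⟩) (by simp)
    rw [← two_mul_sum_sq_eq] at h
    rw [← Finset.sum_div, sampleVar]
    field_simp
    linarith
  rw [← Finset.mul_sum, Finset.sum_comm, Finset.sum_congr rfl fun k _ => key k]
  simp
  field_simp

end PermutationAverage

/-! ### Lower tail of the sample variance -/

section Blocks

variable {Ω : Type*} [MeasurableSpace Ω] {μ : Measure Ω} [IsProbabilityMeasure μ]

/-- Functions of disjoint pairs of independent variables are uncorrelated. -/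
theorem integral_prod_pairs {Z : ℕ → Ω → ℝ} (hZ : ∀ i, Measurable (Z i)) (hind : iIndepFun Z μ)
    {F : ℝ → ℝ → ℝ} (hF : Measurable (Function.uncurry F)) (a b : ℕ → ℕ) (N : ℕ)
    (haa : ∀ i < N, ∀ j < N, i ≠ j → a i ≠ a j) (hbb : ∀ i < N, ∀ j < N, i ≠ j → b i ≠ b j)
    (hab : ∀ i < N, ∀ j < N, i ≠ j → a i ≠ b j) :
    ∫ ω, ∏ k ∈ Finset.range N, F (Z (a k) ω) (Z (b k) ω) ∂μ
      = ∏ k ∈ Finset.range N, ∫ ω, F (Z (a k) ω) (Z (b k) ω) ∂μ := by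
  induction N with
  | zero => simp
  | succ N ih =>
    rw [Finset.prod_range_succ, ← ih (fun i hi j hj => haa i (by omega) j (by omega))
      (fun i hi j hj => hbb i (by omega) j (by omega))
      (fun i hi j hj => hab i (by omega) j (by omega))]
    simp only [Finset.prod_range_succ]
    set S : Finset ℕ := (Finset.range N).image a ∪ (Finset.range N).image b with hS
    set U : Finset ℕ := {a N, b N} with hU
    have hSU : Disjoint S U := by
      rw [Finset.disjoint_left]
      intro x hx hx'
      simp only [hS, hU, Finset.mem_union, Finset.mem_image, Finset.mem_range,
        Finset.mem_insert, Finset.mem_singleton] at hx hx'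
      rcases hx with ⟨i, hi, rfl⟩ | ⟨i, hi, rfl⟩ <;> rcases hx' with h | h
      · exact haa i (by omega) N (by omega) (by omega) h
      · exact hab i (by omega) N (by omega) (by omega) h
      · exact hab N (by omega) i (by omega) (by omega) h.symm
      · exact hbb i (by omega) N (by omega) (by omega) h
    have haS : ∀ k : Fin N, a k ∈ S := fun k =>
      Finset.mem_union_left _ (Finset.mem_image_of_mem _ (Finset.mem_range.2 k.2))
    have hbS : ∀ k : Fin N, b k ∈ S := fun k =>
      Finset.mem_union_right _ (Finset.mem_image_of_mem _ (Finset.mem_range.2 k.2))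
    have haU : a N ∈ U := by simp [hU]
    have hbU : b N ∈ U := by simp [hU]
    have h1 := hind.indepFun_finset S U hSU hZ
    have hpair : ∀ (W : Finset ℕ) (i j : W), Measurable fun x : W → ℝ => F (x i) (x j) :=
      fun W i j => by
        have h := (measurable_pi_apply (X := fun _ : W => ℝ) i).prodMk (measurable_pi_apply j)
        exact hF.comp h
    have h2 := h1.comp
      (φ := fun x : S → ℝ => ∏ k : Fin N, F (x ⟨a k, haS k⟩) (x ⟨b k, hbS k⟩))
      (ψ := fun x : U → ℝ => F (x ⟨a N, haU⟩) (x ⟨b N, hbU⟩))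
      (Finset.measurable_prod _ fun k _ => hpair S _ _) (hpair U _ _)
    have hm : ∀ i j, Measurable fun ω => F (Z i ω) (Z j ω) := fun i j =>
      hF.comp ((hZ i).prodMk (hZ j))
    have h3 := h2.integral_fun_mul_eq_mul_integral
      (Finset.measurable_prod _ fun k _ => hm _ _).aestronglyMeasurable
      (hm _ _).aestronglyMeasurable
    simp only [Finset.prod_range]
    exact h3

/-- The moment generating function of the squared difference of two independent variables. -/
theorem integral_exp_neg_sq_sub_le {X Y : Ω → ℝ} (hX : Measurable X) (hY : Measurable Y)
    (hX01 : ∀ ω, X ω ∈ Set.Icc (0 : ℝ) 1) (hY01 : ∀ ω, Y ω ∈ Set.Icc (0 : ℝ) 1)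
    (hXY : IndepFun X Y μ) {M V : ℝ} (hMX : ∫ ω, X ω ∂μ = M) (hMY : ∫ ω, Y ω ∂μ = M)
    (hVX : Var[X; μ] = V) (hVY : Var[Y; μ] = V) {s : ℝ} (hs : 0 ≤ s) :
    ∫ ω, Real.exp (-s * ((X ω - Y ω) ^ 2 / 2)) ∂μ ≤ Real.exp (-s * V + s ^ 2 * V / 4) := by
  have hpX := memLp_of_mem_Icc (μ := μ) hX hX01 2
  have hpY := memLp_of_mem_Icc (μ := μ) hY hY01 2
  have hsq : ∫ ω, (X ω - Y ω) ^ 2 ∂μ = 2 * V := by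
    have h1 := variance_sub hpX hpY
    rw [hXY.covariance_eq_zero hpX hpY, hVX, hVY, variance_eq_sub (hpX.sub hpY)] at h1
    have h2 : ∫ ω, (X - Y) ω ∂μ = 0 := by
      have := integral_sub (hpX.integrable one_le_two) (hpY.integrable one_le_two)
      rw [hMX, hMY, sub_self] at this
      exact this
    rw [h2] at h1
    simp only [Pi.pow_apply, Pi.sub_apply] at h1
    linarith
  have hint : Integrable (fun ω => (X ω - Y ω) ^ 2) μ := (hpX.sub hpY).integrable_sq
  have hi1 : Integrable (fun ω => (-s / 2 + s ^ 2 / 8) * (X ω - Y ω) ^ 2) μ := hint.const_mul _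
  calc ∫ ω, Real.exp (-s * ((X ω - Y ω) ^ 2 / 2)) ∂μ
      ≤ ∫ ω, (1 + (-s / 2 + s ^ 2 / 8) * (X ω - Y ω) ^ 2) ∂μ := by
        refine integral_mono_of_nonneg (ae_of_all _ fun ω => (Real.exp_pos _).le)
          ((integrable_const 1).add hi1) (ae_of_all _ fun ω => ?_)
        have h1 : -s * ((X ω - Y ω) ^ 2 / 2) ≤ 0 := by
          have : 0 ≤ s * ((X ω - Y ω) ^ 2 / 2) := by positivity
          linarith
        refine (exp_le_quadratic_of_nonpos h1).trans ?_
        -- As (X - Y)² ≤ 1, its square is at most itself; the second-order term becomes a multiple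
        -- of (X - Y)², whose mean is 2V.
        have h2 : (X ω - Y ω) ^ 2 ≤ 1 := by
          rw [sq_le_one_iff_abs_le_one, abs_le]
          constructor <;> linarith [(hX01 ω).1, (hX01 ω).2, (hY01 ω).1, (hY01 ω).2]
        have h3 : 0 ≤ s ^ 2 * (X ω - Y ω) ^ 2 := by positivity
        nlinarith [mul_le_mul_of_nonneg_left h2 h3]
    _ = 1 + (-s * V + s ^ 2 * V / 4) := by
        rw [integral_add (integrable_const 1) hi1, integral_const_mul, hsq]
        simp; ring
    _ ≤ _ := by
        have := Real.add_one_le_exp (-s * V + s ^ 2 * V / 4)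
        linarith

/-- The lower tail of the sample variance. -/
theorem sampleVar_lower_tail {Z : ℕ → Ω → ℝ} (hZ : ∀ i, Measurable (Z i))
    (h01 : ∀ i ω, Z i ω ∈ Set.Icc (0 : ℝ) 1) (hind : iIndepFun Z μ) {M V : ℝ}
    (hM : ∀ i, ∫ ω, Z i ω ∂μ = M) (hV : ∀ i, Var[Z i; μ] = V) (hVpos : 0 < V) {n : ℕ}
    (hn : 2 ≤ n) {t : ℝ} (ht : 0 ≤ t) :
    μ.real {ω | sampleVar (fun i => Z i ω) n ≤ V - t}
      ≤ Real.exp (-((n - 1) * t ^ 2 / (2 * V))) := by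
  set N := n / 2 with hN
  have hN2 : 2 * N ≤ n := by omega
  -- For odd n one sample stays unpaired; this is why n - 1 appears in the tail.
  have hNn : ((n : ℝ) - 1) / 2 ≤ N := by
    have : n ≤ 2 * N + 1 := by omega
    have : (n : ℝ) ≤ 2 * N + 1 := by exact_mod_cast this
    linarith
  -- The minimizer of -s t + s² V/4, with value -t²/V per pair.
  set s : ℝ := 2 * t / V with hs
  have hs0 : 0 ≤ s := by positivity
  set Y : Equiv.Perm (Fin n) → Ω → ℝ := fun σ ω => ∑ k : Fin N,
    (Z (σ ⟨2 * k, by omega⟩) ω - Z (σ ⟨2 * k + 1, by omega⟩) ω) ^ 2 / 2 with hY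
  set c : ℝ := (Fintype.card (Equiv.Perm (Fin n)) : ℝ)⁻¹ with hc
  have hc0 : 0 < c := by
    rw [hc]; exact inv_pos.2 (by exact_mod_cast Fintype.card_pos)
  have hcsum : ∑ _σ : Equiv.Perm (Fin n), c = 1 := by
    rw [Finset.sum_const, nsmul_eq_mul, Finset.card_univ, hc]
    exact mul_inv_cancel₀ (by exact_mod_cast Fintype.card_ne_zero)
  have hY0 : ∀ σ ω, 0 ≤ Y σ ω := fun σ ω => Finset.sum_nonneg fun k _ => by positivity
  have hYm : ∀ σ, Measurable (Y σ) := fun σ =>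
    Finset.measurable_sum _ fun k _ => (((hZ _).sub (hZ _)).pow_const 2).div_const 2
  have havg : ∀ ω, (N : ℝ) * sampleVar (fun i => Z i ω) n = ∑ σ, c * Y σ ω := fun ω =>
    sampleVar_eq_average (fun i => Z i ω) hn hN2
  have hexp : ∀ σ, ∫ ω, Real.exp (-s * Y σ ω) ∂μ ≤ Real.exp (-s * V + s ^ 2 * V / 4) ^ N := by
    intro σ
    -- The permutation extended to ℕ; the pairs use only its values below n, where it is injective.
    set e : ℕ → ℕ := fun i => if h : i < n then (σ ⟨i, h⟩ : Fin n) else i with he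
    have hinj : ∀ i < n, ∀ j < n, i ≠ j → e i ≠ e j := by
      intro i hi j hj hij h
      simp only [he, hi, hj, dif_pos] at h
      have := σ.injective (Fin.ext h)
      exact hij (by simpa using this)
    have hF : Measurable (Function.uncurry fun x y : ℝ => Real.exp (-s * ((x - y) ^ 2 / 2))) := by
      unfold Function.uncurry
      fun_prop
    have h1 := integral_prod_pairs hZ hind hF (fun k => e (2 * k)) (fun k => e (2 * k + 1)) N
      (fun i hi j hj hij => hinj _ (by omega) _ (by omega) (by omega))
      (fun i hi j hj hij => hinj _ (by omega) _ (by omega) (by omega))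
      (fun i hi j hj hij => hinj _ (by omega) _ (by omega) (by omega))
    have h2 : ∀ ω, Real.exp (-s * Y σ ω) = ∏ k ∈ Finset.range N,
        Real.exp (-s * ((Z (e (2 * k)) ω - Z (e (2 * k + 1)) ω) ^ 2 / 2)) := by
      intro ω
      rw [Finset.prod_range, ← Real.exp_sum, hY, Finset.mul_sum]
      congr 1
      refine Finset.sum_congr rfl fun k _ => ?_
      have hk1 : 2 * (k : ℕ) < n := by omega
      have hk2 : 2 * (k : ℕ) + 1 < n := by omega
      simp only [he, hk1, hk2, dif_pos]
    simp only [h2]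
    rw [h1]
    calc _ ≤ ∏ k ∈ Finset.range N, Real.exp (-s * V + s ^ 2 * V / 4) := by
          refine Finset.prod_le_prod (fun k _ => integral_nonneg fun ω => (Real.exp_pos _).le)
            fun k hk => ?_
          have hk' := Finset.mem_range.1 hk
          exact integral_exp_neg_sq_sub_le (hZ _) (hZ _) (h01 _) (h01 _)
            (hind.indepFun (hinj _ (by omega) _ (by omega) (by omega))) (hM _) (hM _) (hV _)
            (hV _) hs0
      _ = _ := by simp
  have hEint : ∀ σ, Integrable (fun ω => Real.exp (-s * Y σ ω)) μ := fun σ =>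
    integrable_of_mem_Icc (a := 0) (b := 1) ((hYm σ).const_mul _).exp fun ω =>
      ⟨(Real.exp_pos _).le, Real.exp_le_one_iff.2 (by nlinarith [hY0 σ ω])⟩
  have hbound : ∫ ω, Real.exp (-s * ∑ σ, c * Y σ ω) ∂μ
      ≤ Real.exp (-s * V + s ^ 2 * V / 4) ^ N := by
    calc _ ≤ ∫ ω, ∑ σ, c * Real.exp (-s * Y σ ω) ∂μ := by
          refine integral_mono_of_nonneg (ae_of_all _ fun ω => (Real.exp_pos _).le)
            (integrable_finsetSum _ fun σ _ => (hEint σ).const_mul c) (ae_of_all _ fun ω => ?_)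
          -- Jensen's inequality over the permutations: the pairs of one permutation are
          -- independent, although those of different permutations are not.
          have := convexOn_exp.map_sum_le (t := Finset.univ) (w := fun _ => c)
            (p := fun σ : Equiv.Perm (Fin n) => -s * Y σ ω) (fun _ _ => hc0.le) hcsum
            (fun _ _ => Set.mem_univ _)
          simp only [smul_eq_mul] at this
          convert this using 2
          rw [Finset.mul_sum]
          exact Finset.sum_congr rfl fun σ _ => by ring
      _ = ∑ σ, c * ∫ ω, Real.exp (-s * Y σ ω) ∂μ := by
          rw [integral_finsetSum _ fun σ _ => (hEint σ).const_mul c]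
          simp only [integral_const_mul]
      _ ≤ ∑ _σ : Equiv.Perm (Fin n), c * Real.exp (-s * V + s ^ 2 * V / 4) ^ N := by
          gcongr with σ; exact hexp σ
      _ = _ := by rw [← Finset.sum_mul, hcsum, one_mul]
  have hTm : Measurable fun ω => ∑ σ, c * Y σ ω :=
    Finset.measurable_sum _ fun σ _ => (hYm σ).const_mul c
  have hch := measure_le_le_exp_mul_mgf (μ := μ) (X := fun ω => ∑ σ, c * Y σ ω) (N * (V - t))
    (t := -s) (by linarith)
    (integrable_of_mem_Icc (a := 0) (b := 1) (hTm.const_mul _).exp fun ω =>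
      ⟨(Real.exp_pos _).le, Real.exp_le_one_iff.2 (by
        have : 0 ≤ ∑ σ, c * Y σ ω := Finset.sum_nonneg fun σ _ => mul_nonneg hc0.le (hY0 σ ω)
        nlinarith)⟩)
  have hsub : μ.real {ω | sampleVar (fun i => Z i ω) n ≤ V - t}
      ≤ μ.real {ω | ∑ σ, c * Y σ ω ≤ N * (V - t)} := by
    refine measureReal_mono fun ω hω => ?_
    change ∑ σ, c * Y σ ω ≤ N * (V - t)
    rw [← havg]
    exact mul_le_mul_of_nonneg_left hω (by positivity)
  refine hsub.trans (hch.trans ?_)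
  refine (mul_le_mul_of_nonneg_left hbound (Real.exp_pos _).le).trans ?_
  rw [← Real.exp_nat_mul, ← Real.exp_add, Real.exp_le_exp]
  have h1 : - -s * (N * (V - t)) + N * (-s * V + s ^ 2 * V / 4) = -(N * (t ^ 2 / V)) := by
    rw [hs]; field_simp; ring
  have h2 : ((n : ℝ) - 1) * t ^ 2 / (2 * V) = (n - 1) / 2 * (t ^ 2 / V) := by
    field_simp
  rw [h1, h2]
  have : 0 ≤ t ^ 2 / V := by positivity
  nlinarith [mul_le_mul_of_nonneg_right hNn this]

/-- The standard deviation is at most its estimate plus `√(2 L / (n - 1))`, with high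
probability. -/
theorem sqrt_variance_tail {Z : ℕ → Ω → ℝ} (hZ : ∀ i, Measurable (Z i))
    (h01 : ∀ i ω, Z i ω ∈ Set.Icc (0 : ℝ) 1) (hind : iIndepFun Z μ) {M V : ℝ}
    (hM : ∀ i, ∫ ω, Z i ω ∂μ = M) (hV : ∀ i, Var[Z i; μ] = V) {n : ℕ}
    (hn : 2 ≤ n) {L : ℝ} (hL : 0 < L) :
    μ.real {ω | Real.sqrt (sampleVar (fun i => Z i ω) n) + Real.sqrt (2 * L / (n - 1))
      < Real.sqrt V} ≤ Real.exp (-L) := by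
  have hn1 : (0 : ℝ) < n - 1 := by
    have : (2 : ℝ) ≤ n := by exact_mod_cast hn
    linarith
  have hV0 : 0 ≤ V := hV 0 ▸ variance_nonneg _ _
  rcases hV0.eq_or_lt with h0 | hVpos
  · have : {ω | Real.sqrt (sampleVar (fun i => Z i ω) n) + Real.sqrt (2 * L / (n - 1))
      < Real.sqrt V} = ∅ := by
      ext ω
      simp only [Set.mem_ofPred_eq, Set.mem_empty_iff_false, iff_false, not_lt, ← h0,
        Real.sqrt_zero]
      positivity
    rw [this]
    simp [(Real.exp_pos _).le]
  set t := Real.sqrt (2 * V * L / (n - 1)) with ht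
  have h1 := sampleVar_lower_tail hZ h01 hind hM hV hVpos hn (t := t) (Real.sqrt_nonneg _)
  have h2 : ((n : ℝ) - 1) * t ^ 2 / (2 * V) = L := by
    rw [ht, Real.sq_sqrt (by positivity)]; field_simp
  rw [h2] at h1
  refine (measureReal_mono fun ω hω => ?_).trans h1
  change sampleVar (fun i => Z i ω) n ≤ V - t
  have hω' : Real.sqrt (sampleVar (fun i => Z i ω) n) + Real.sqrt (2 * L / (n - 1))
      < Real.sqrt V := hω
  set w := Real.sqrt (sampleVar (fun i => Z i ω) n) with hw
  set r := Real.sqrt (2 * L / (n - 1)) with hr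
  have hw0 : 0 ≤ w := Real.sqrt_nonneg _
  have hr0 : 0 ≤ r := Real.sqrt_nonneg _
  have htr : t = Real.sqrt V * r := by
    rw [ht, hr, ← Real.sqrt_mul hV0]; congr 1; ring
  have hVs : V = Real.sqrt V ^ 2 := (Real.sq_sqrt hV0).symm
  have hsv : sampleVar (fun i => Z i ω) n ≤ w ^ 2 := by
    rcases le_total 0 (sampleVar (fun i => Z i ω) n) with h | h
    · rw [hw, Real.sq_sqrt h]
    · exact h.trans (sq_nonneg _)
  -- Since r ≤ √V on this event, (√V - r)² ≤ V - √V r = V - t.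
  have h3 : w ^ 2 ≤ (Real.sqrt V - r) ^ 2 := by
    apply pow_le_pow_left₀ hw0; linarith
  rw [htr]
  nlinarith

end Blocks

/-! ### Empirical Bernstein bounds -/

section EmpiricalBernstein

/-- The empirical Bernstein radius with logarithmic factor `L`. -/
def bernsteinRadius (L R : ℝ) (z : ℕ → ℝ) (n : ℕ) : ℝ :=
  Real.sqrt (2 * sampleVar z n / n * L) + 7 * R / (3 * ((n : ℝ) - 1)) * L

theorem radius_eq_bernsteinRadius (d : ℕ) (δ R : ℝ) (z : ℕ → ℝ) (n : ℕ) :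
    radius d δ R z n = bernsteinRadius (Real.log (4 * d / δ)) R z n := rfl

theorem sampleVar_div (z : ℕ → ℝ) (R : ℝ) (n : ℕ) :
    sampleVar (fun i => z i / R) n = sampleVar z n / R ^ 2 := by
  simp only [sampleVar, ← sub_div, div_pow, ← Finset.sum_div]
  ring

theorem sampleMean_div (z : ℕ → ℝ) (R : ℝ) (n : ℕ) :
    sampleMean (fun i => z i / R) n = sampleMean z n / R := by
  simp only [sampleMean, ← Finset.sum_div]
  ring

theorem bernsteinRadius_div (L : ℝ) {R : ℝ} (hR : 0 < R) (z : ℕ → ℝ) (n : ℕ) :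
    bernsteinRadius L 1 (fun i => z i / R) n = bernsteinRadius L R z n / R := by
  rw [bernsteinRadius, bernsteinRadius, sampleVar_div, add_div]
  have h1 : 2 * (sampleVar z n / R ^ 2) / n * L = 2 * sampleVar z n / n * L / R ^ 2 := by ring
  rw [h1, Real.sqrt_div' _ (sq_nonneg R), Real.sqrt_sq hR.le]
  congr 1
  field_simp

theorem sampleVar_nonneg (z : ℕ → ℝ) (n : ℕ) : 0 ≤ sampleVar z n := by
  refine div_nonneg (Finset.sum_nonneg fun j _ => Finset.sum_nonneg fun i _ => sq_nonneg _) ?_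
  rcases Nat.eq_zero_or_pos n with rfl | hn
  · simp
  · have : (1 : ℝ) ≤ n := by exact_mod_cast hn
    exact mul_nonneg (by linarith) (by linarith)

theorem sampleVar_le {z : ℕ → ℝ} {R : ℝ} (hz : ∀ i, z i ∈ Set.Icc 0 R) {n : ℕ} (hn : 2 ≤ n) :
    sampleVar z n ≤ R ^ 2 / 2 := by
  have hn' : (2 : ℝ) ≤ n := by exact_mod_cast hn
  rw [sampleVar, div_le_iff₀ (mul_pos (by linarith) (by linarith))]
  have h1 : ∀ i j, (z i - z j) ^ 2 ≤ R ^ 2 := fun i j => by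
    apply sq_le_sq'
    · linarith [(hz i).1, (hz j).2]
    · linarith [(hz j).1, (hz i).2]
  have h2 : ((∑ j ∈ Finset.range n, j : ℕ) : ℝ) = n * (n - 1) / 2 := by
    have := Finset.sum_range_id_mul_two n
    have h3 : ((∑ j ∈ Finset.range n, j : ℕ) : ℝ) * 2 = n * ((n - 1 : ℕ) : ℝ) := by
      exact_mod_cast this
    rw [Nat.cast_sub (by omega)] at h3
    push_cast at h3 ⊢
    linarith
  calc ∑ j ∈ Finset.range n, ∑ i ∈ Finset.range j, (z i - z j) ^ 2
      ≤ ∑ j ∈ Finset.range n, ∑ i ∈ Finset.range j, R ^ 2 := by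
        exact Finset.sum_le_sum fun j _ => Finset.sum_le_sum fun i _ => h1 i j
    _ = ((∑ j ∈ Finset.range n, j : ℕ) : ℝ) * R ^ 2 := by
        simp [Finset.sum_mul]
    _ = _ := by rw [h2]; ring

theorem bernsteinRadius_nonneg {L R : ℝ} (hL : 0 ≤ L) (hR : 0 ≤ R) (z : ℕ → ℝ) {n : ℕ}
    (hn : 2 ≤ n) : 0 ≤ bernsteinRadius L R z n := by
  have hn' : (2 : ℝ) ≤ n := by exact_mod_cast hn
  exact add_nonneg (Real.sqrt_nonneg _)
    (mul_nonneg (div_nonneg (by linarith) (by linarith)) hL)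

/-- Accuracy is required at level 3L, while the algorithm uses the radius at level L; the change of
level costs only a constant. -/
theorem bernsteinRadius_three_mul_le {L R : ℝ} (hL : 0 ≤ L) (z : ℕ → ℝ) (n : ℕ) :
    bernsteinRadius (3 * L) R z n ≤ 3 * bernsteinRadius L R z n := by
  rw [bernsteinRadius, bernsteinRadius]
  have h0 : 0 ≤ 2 * sampleVar z n / n * L := by
    have := sampleVar_nonneg z n
    positivity
  have h1 : Real.sqrt (2 * sampleVar z n / n * (3 * L))
      ≤ 3 * Real.sqrt (2 * sampleVar z n / n * L) := by
    rw [Real.sqrt_le_left (by positivity), mul_pow, Real.sq_sqrt h0]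
    linarith
  linarith

theorem const_div_le {R L : ℝ} (hR : 0 ≤ R) (hL : 0 ≤ L) {n : ℕ} (hn : 2 ≤ n) :
    7 * R / (3 * ((n : ℝ) - 1)) * L ≤ 5 * R * L / n := by
  have hn' : (2 : ℝ) ≤ n := by exact_mod_cast hn
  rw [div_mul_eq_mul_div, div_le_div_iff₀ (by linarith) (by linarith)]
  have : 0 ≤ R * L := mul_nonneg hR hL
  nlinarith

/-- The worst case: the sample variance is at most R²/2, and √L ≤ L. The regret bound uses the
radius only through this rate. -/
theorem bernsteinRadius_le {z : ℕ → ℝ} {R L : ℝ} (hL : 1 ≤ L) (hz : ∀ i, z i ∈ Set.Icc 0 R)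
    {n : ℕ} (hn : 2 ≤ n) : bernsteinRadius L R z n ≤ 6 * R * L / Real.sqrt n := by
  have hn' : (2 : ℝ) ≤ n := by exact_mod_cast hn
  have hn0 : (0 : ℝ) < n := by linarith
  have hR : 0 ≤ R := (hz 0).1.trans (hz 0).2
  have hs1 : 0 < Real.sqrt n := Real.sqrt_pos.2 hn0
  have h1 : Real.sqrt (2 * sampleVar z n / n * L) ≤ R * L / Real.sqrt n := by
    rw [Real.sqrt_le_left (by positivity), div_pow, Real.sq_sqrt hn0.le, mul_pow,
      div_mul_eq_mul_div]
    have := sampleVar_le hz hn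
    gcongr
    · linarith
    · nlinarith
  have h2 : 5 * R * L / n ≤ 5 * R * L / Real.sqrt n := by
    gcongr
    rw [Real.sqrt_le_left hn0.le]
    nlinarith
  have h3 := const_div_le hR (zero_le_one.trans hL) hn
  have h4 : 6 * R * L / Real.sqrt n = R * L / Real.sqrt n + 5 * R * L / Real.sqrt n := by ring
  rw [bernsteinRadius, h4]
  linarith

/-- The empirical Bernstein bound, on the event where the estimates of the mean and the variance
are accurate. -/
theorem mean_sub_le_bernsteinRadius {z : ℕ → ℝ} {n : ℕ} (hn : 2 ≤ n) {S V L : ℝ} (hL : 0 < L)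
    (hV : 0 ≤ V)
    (hsum : S < Real.sqrt (2 * (n * V) * L) + L / 3)
    (hvar : Real.sqrt V ≤ Real.sqrt (sampleVar z n) + Real.sqrt (2 * L / (n - 1))) :
    S / n ≤ bernsteinRadius L 1 z n := by
  have hn' : (2 : ℝ) ≤ n := by exact_mod_cast hn
  have hn0 : (0 : ℝ) < n := by linarith
  have hn1 : (0 : ℝ) < n - 1 := by linarith
  have h1 : Real.sqrt (2 * (n * V) * L) = n * (Real.sqrt V * Real.sqrt (2 * L / n)) := by
    rw [← Real.sqrt_mul hV, Real.sqrt_eq_iff_mul_self_eq (by positivity) (by positivity)]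
    have := Real.mul_self_sqrt (show 0 ≤ V * (2 * L / n) by positivity)
    calc _ = (n : ℝ) ^ 2 * (V * (2 * L / n)) := by field_simp
      _ = (n : ℝ) ^ 2 * (Real.sqrt (V * (2 * L / n)) * Real.sqrt (V * (2 * L / n))) := by rw [this]
      _ = _ := by ring
  have h2 : Real.sqrt (2 * L / n) ≤ Real.sqrt (2 * L / (n - 1)) := by
    apply Real.sqrt_le_sqrt
    gcongr
    linarith
  have h3 : Real.sqrt (sampleVar z n) * Real.sqrt (2 * L / n)
      = Real.sqrt (2 * sampleVar z n / n * L) := by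
    rw [← Real.sqrt_mul (sampleVar_nonneg z n)]; congr 1; ring
  have h4 : Real.sqrt (2 * L / (n - 1)) * Real.sqrt (2 * L / (n - 1)) = 2 * L / (n - 1) :=
    Real.mul_self_sqrt (by positivity)
  have h5 : Real.sqrt V * Real.sqrt (2 * L / n)
      ≤ Real.sqrt (2 * sampleVar z n / n * L) + 2 * L / (n - 1) := by
    calc _ ≤ (Real.sqrt (sampleVar z n) + Real.sqrt (2 * L / (n - 1))) * Real.sqrt (2 * L / n) := by
          gcongr
      _ ≤ _ := by
          rw [add_mul, h3]
          have := mul_le_mul_of_nonneg_left h2 (Real.sqrt_nonneg (2 * L / ((n : ℝ) - 1)))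
          linarith
  have h6 : L / 3 / n ≤ L / 3 / (n - 1) := by
    gcongr
    linarith
  -- The constant is 7/3 = 2 + 1/3: the 2 comes from replacing √V by its estimate, the 1/3 from
  -- Bernstein's inequality.
  have h7 : 7 * 1 / (3 * ((n : ℝ) - 1)) * L = 2 * L / (n - 1) + L / 3 / (n - 1) := by
    field_simp; ring
  calc S / n ≤ (n * (Real.sqrt V * Real.sqrt (2 * L / n)) + L / 3) / n := by
        rw [← h1]; gcongr
    _ = Real.sqrt V * Real.sqrt (2 * L / n) + L / 3 / n := by field_simp
    _ ≤ _ := by rw [bernsteinRadius, h7]; linarith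

variable {Ω : Type*} [MeasurableSpace Ω] {μ : Measure Ω} [IsProbabilityMeasure μ]

theorem sampleMean_sub_const (z : ℕ → ℝ) (M : ℝ) {n : ℕ} (hn : 0 < n) :
    (∑ i ∈ Finset.range n, (z i - M)) / n = sampleMean z n - M := by
  have : (n : ℝ) ≠ 0 := by positivity
  rw [sampleMean, Finset.sum_sub_distrib]
  simp
  field_simp

/-- The three events on which the empirical Bernstein bounds of a mean may fail. -/
theorem exists_bernstein_events {Z : ℕ → Ω → ℝ} (hZ : ∀ i, Measurable (Z i)) {R : ℝ} (hR : 0 < R)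
    (h0R : ∀ i ω, Z i ω ∈ Set.Icc 0 R) (hind : iIndepFun Z μ) {M V : ℝ}
    (hM : ∀ i, ∫ ω, Z i ω ∂μ = M) (hV : ∀ i, Var[Z i; μ] = V) {n : ℕ} (hn : 2 ≤ n) {L : ℝ}
    (hL : 0 < L) :
    ∃ A₁ A₂ B : Set Ω, μ.real A₁ ≤ Real.exp (-L) ∧ μ.real A₂ ≤ Real.exp (-L) ∧
      μ.real B ≤ Real.exp (-L) ∧
      (∀ ω, ω ∉ A₁ → ω ∉ B → sampleMean (fun i => Z i ω) n - M
        ≤ bernsteinRadius L R (fun i => Z i ω) n) ∧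
      (∀ ω, ω ∉ A₂ → ω ∉ B → M - sampleMean (fun i => Z i ω) n
        ≤ bernsteinRadius L R (fun i => Z i ω) n) := by
  have hn0 : 0 < n := by omega
  set Y : ℕ → Ω → ℝ := fun i ω => Z i ω / R with hY
  have hYm : ∀ i, Measurable (Y i) := fun i => (hZ i).div_const R
  have hY01 : ∀ i ω, Y i ω ∈ Set.Icc (0 : ℝ) 1 := fun i ω =>
    ⟨div_nonneg (h0R i ω).1 hR.le, (div_le_one hR).2 (h0R i ω).2⟩
  have hYind : iIndepFun Y μ := hind.comp (fun _ x => x / R) fun _ => measurable_id.div_const R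
  have hYM : ∀ i, ∫ ω, Y i ω ∂μ = M / R := fun i => by
    simp only [hY]
    rw [integral_div, hM i]
  have hYV : ∀ i, Var[Y i; μ] = V / R ^ 2 := fun i => by
    have : Y i = fun ω => R⁻¹ * Z i ω := by
      ext ω; simp only [hY]; ring
    rw [this, variance_const_mul, hV i]
    field_simp
  have hV0 : 0 ≤ V / R ^ 2 := hYV 0 ▸ variance_nonneg _ _
  -- Lower deviations of Y are upper deviations of 1 - Y, which has the same variance. Hence one
  -- variance event serves both sides, and three events suffice.
  have hWm : ∀ i, Measurable (fun ω => 1 - Y i ω) := fun i => (hYm i).const_sub 1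
  have hW01 : ∀ i ω, 1 - Y i ω ∈ Set.Icc (0 : ℝ) 1 := fun i ω =>
    ⟨by linarith [(hY01 i ω).2], by linarith [(hY01 i ω).1]⟩
  have hWind : iIndepFun (fun i ω => 1 - Y i ω) μ :=
    hYind.comp (fun _ x => 1 - x) fun _ => measurable_id.const_sub 1
  have hWM : ∀ i, ∫ ω, (1 - Y i ω) ∂μ = 1 - M / R := fun i => by
    rw [integral_sub (integrable_const 1) (integrable_of_mem_Icc (hYm i) (hY01 i)), hYM i]
    simp
  have hWV : ∀ i, Var[fun ω => 1 - Y i ω; μ] = V / R ^ 2 := fun i => by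
    rw [variance_const_sub (hYm i).aestronglyMeasurable, hYV i]
  refine ⟨_, _, _, bernstein_sum hYm hY01 hYind hYM hYV n hn0 hL,
    bernstein_sum hWm hW01 hWind hWM hWV n hn0 hL,
    sqrt_variance_tail hYm hY01 hYind hYM hYV hn hL, fun ω hA hB => ?_, fun ω hA hB => ?_⟩
  · simp only [Set.mem_ofPred_eq, not_le, not_lt] at hA hB
    have h := mean_sub_le_bernsteinRadius hn hL hV0 hA hB
    rw [sampleMean_sub_const _ _ hn0, sampleMean_div, bernsteinRadius_div L hR, ← sub_div] at h
    exact (div_le_div_iff_of_pos_right hR).1 h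
  · simp only [Set.mem_ofPred_eq, not_le, not_lt] at hA hB
    have h := mean_sub_le_bernsteinRadius hn hL hV0 hA hB
    have h1 : ∑ i ∈ Finset.range n, (1 - Y i ω - (1 - M / R))
        = -∑ i ∈ Finset.range n, (Y i ω - M / R) := by
      rw [← Finset.sum_neg_distrib]
      exact Finset.sum_congr rfl fun i _ => by ring
    rw [h1, neg_div, sampleMean_sub_const _ _ hn0, sampleMean_div, bernsteinRadius_div L hR,
      ← sub_div, ← neg_div] at h
    have := (div_le_div_iff_of_pos_right hR).1 h
    linarith

/-- The upper **empirical Bernstein bound**. -/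
theorem empirical_bernstein_upper {Z : ℕ → Ω → ℝ} (hZ : ∀ i, Measurable (Z i)) {R : ℝ}
    (hR : 0 < R) (h0R : ∀ i ω, Z i ω ∈ Set.Icc 0 R) (hind : iIndepFun Z μ) {M V : ℝ}
    (hM : ∀ i, ∫ ω, Z i ω ∂μ = M) (hV : ∀ i, Var[Z i; μ] = V) {n : ℕ} (hn : 2 ≤ n) {L : ℝ}
    (hL : 0 < L) :
    μ.real {ω | ¬ sampleMean (fun i => Z i ω) n - M ≤ bernsteinRadius L R (fun i => Z i ω) n}
      ≤ 2 * Real.exp (-L) := by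
  obtain ⟨A₁, A₂, B, h1, h2, h3, h4, h5⟩ := exists_bernstein_events hZ hR h0R hind hM hV hn hL
  calc _ ≤ μ.real (A₁ ∪ B) := by
        refine measureReal_mono fun ω hω => ?_
        by_contra h
        simp only [Set.mem_union, not_or] at h
        exact hω (h4 ω h.1 h.2)
    _ ≤ μ.real A₁ + μ.real B := measureReal_union_le _ _
    _ ≤ _ := by linarith

/-- The two-sided **empirical Bernstein bound**. -/
theorem empirical_bernstein {Z : ℕ → Ω → ℝ} (hZ : ∀ i, Measurable (Z i)) {R : ℝ}
    (hR : 0 < R) (h0R : ∀ i ω, Z i ω ∈ Set.Icc 0 R) (hind : iIndepFun Z μ) {M V : ℝ}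
    (hM : ∀ i, ∫ ω, Z i ω ∂μ = M) (hV : ∀ i, Var[Z i; μ] = V) {n : ℕ} (hn : 2 ≤ n) {L : ℝ}
    (hL : 0 < L) :
    μ.real {ω | ¬ |sampleMean (fun i => Z i ω) n - M| ≤ bernsteinRadius L R (fun i => Z i ω) n}
      ≤ 3 * Real.exp (-L) := by
  obtain ⟨A₁, A₂, B, h1, h2, h3, h4, h5⟩ := exists_bernstein_events hZ hR h0R hind hM hV hn hL
  calc _ ≤ μ.real (A₁ ∪ A₂ ∪ B) := by
        refine measureReal_mono fun ω hω => ?_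
        by_contra h
        simp only [Set.mem_union, not_or] at h
        have := h5 ω h.1.2 h.2
        exact hω (abs_le.2 ⟨by linarith, h4 ω h.1.1 h.2⟩)
    _ ≤ μ.real A₁ + μ.real A₂ + μ.real B :=
        (measureReal_union_le _ _).trans (by gcongr; exact measureReal_union_le _ _)
    _ ≤ _ := by linarith

end EmpiricalBernstein

/-! ### The function -x log x -/

section NegMulLog

/-- Concavity, from log (p/y) ≤ p/y - 1. The point y = 0 is included because a clipped estimate may
vanish. -/
theorem negMulLog_le_tangent {p y : ℝ} (hp : 0 < p) (hy : 0 ≤ y) :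
    Real.negMulLog y ≤ Real.negMulLog p + (-Real.log p - 1) * (y - p) := by
  rcases hy.eq_or_lt with rfl | hy
  · simp only [Real.negMulLog]
    nlinarith
  · have h := Real.log_le_sub_one_of_pos (div_pos hp hy)
    rw [Real.log_div hp.ne' hy.ne'] at h
    have h1 := mul_le_mul_of_nonneg_left h hy.le
    have h2 : y * (p / y - 1) = p - y := by field_simp
    rw [h2] at h1
    simp only [Real.negMulLog]
    nlinarith

theorem negMulLog_le_of_le_exp {p y : ℝ} (hp : 0 ≤ p) (hpy : p ≤ y) (hy : y ≤ Real.exp (-1)) :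
    Real.negMulLog p ≤ Real.negMulLog y := by
  rcases (hp.trans hpy).eq_or_lt with h0 | hy0
  · rw [show p = y by linarith]
  · have h1 := negMulLog_le_tangent hy0 hp
    have h2 : Real.log y ≤ -1 := by
      rw [← Real.log_exp (-1)]; exact Real.log_le_log hy0 hy
    nlinarith

theorem negMulLog_le_of_exp_le {p y : ℝ} (hpy : y ≤ p) (hy : Real.exp (-1) ≤ y) :
    Real.negMulLog p ≤ Real.negMulLog y := by
  have hy0 : 0 < y := (Real.exp_pos _).trans_le hy
  have h1 := negMulLog_le_tangent hy0 (hy0.le.trans hpy)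
  have h2 : -1 ≤ Real.log y := by
    rw [← Real.log_exp (-1)]; exact Real.log_le_log (Real.exp_pos _) hy
  nlinarith

/-- A substitute for the tangent bound at 0, where the slope is infinite; it is log t ≤ t - 1 at t =
1/√x. -/
theorem negMulLog_le_two_mul_sqrt {x : ℝ} (hx : 0 ≤ x) :
    Real.negMulLog x ≤ 2 * Real.sqrt x := by
  rcases hx.eq_or_lt with rfl | hx
  · simp
  · have hs : 0 < Real.sqrt x := Real.sqrt_pos.2 hx
    have h1 := Real.log_le_sub_one_of_pos (inv_pos.2 hs)
    rw [Real.log_inv, Real.log_sqrt hx.le] at h1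
    have h2 : x * (Real.sqrt x)⁻¹ = Real.sqrt x := by
      have := Real.mul_self_sqrt hx.le
      field_simp
      nlinarith
    have h3 := mul_le_mul_of_nonneg_left h1 hx.le
    rw [mul_sub, h2] at h3
    simp only [Real.negMulLog]
    nlinarith

end NegMulLog

/-! ### Clipping towards the maximizer of -x log x -/

section Clip

theorem clip_of_le {p ε : ℝ} (hp : p ≤ Real.exp (-1)) :
    clip p ε = p + ε ∧ p + ε ≤ Real.exp (-1) ∨ clip p ε = Real.exp (-1) ∧
      Real.exp (-1) - p ≤ max ε 0 := by
  have habs : |Real.exp (-1) - p| = Real.exp (-1) - p := abs_of_nonneg (by linarith)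
  rw [clip, habs]
  split_ifs with h
  -- At p = e⁻¹ the direction is 0/0 = 0, so the point does not move, whatever ε is.
  · rcases hp.eq_or_lt with h0 | h0
    · right
      rw [h0]; simp
    · left
      rw [div_self (by linarith)]
      exact ⟨by ring, by linarith⟩
  · right
    exact ⟨rfl, by rw [le_max_iff]; left; linarith⟩

theorem clip_of_lt {p ε : ℝ} (hp : Real.exp (-1) < p) :
    clip p ε = p - ε ∧ Real.exp (-1) ≤ p - ε ∨ clip p ε = Real.exp (-1) ∧
      p - Real.exp (-1) ≤ ε := by
  have habs : |Real.exp (-1) - p| = p - Real.exp (-1) := by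
    rw [abs_of_neg (by linarith)]; ring
  rw [clip, habs]
  split_ifs with h
  · left
    have : (Real.exp (-1) - p) / (p - Real.exp (-1)) = -1 := by
      rw [div_eq_iff (by linarith)]; ring
    rw [this]
    exact ⟨by ring, by linarith⟩
  · right
    exact ⟨rfl, by linarith⟩

theorem exp_neg_one_le_one : Real.exp (-1) ≤ 1 := Real.exp_le_one_iff.2 (by norm_num)

theorem clip_mem_Icc {p ε : ℝ} (hε : 0 ≤ ε) (hp : p ∈ Set.Icc (0 : ℝ) 1) :
    clip p ε ∈ Set.Icc (0 : ℝ) 1 := by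
  have he := Real.exp_pos (-1)
  have he1 := exp_neg_one_le_one
  obtain ⟨hp0, hp1⟩ := hp
  rcases le_or_gt p (Real.exp (-1)) with h | h
  · rcases clip_of_le (ε := ε) h with ⟨h1, h2⟩ | ⟨h1, -⟩ <;> rw [h1] <;>
      constructor <;> linarith
  · rcases clip_of_lt (ε := ε) h with ⟨h1, h2⟩ | ⟨h1, -⟩ <;> rw [h1] <;>
      constructor <;> linarith

theorem abs_clip_sub_le {p ε : ℝ} (hε : 0 ≤ ε) : |clip p ε - p| ≤ ε := by
  rcases le_or_gt p (Real.exp (-1)) with h | h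
  · rcases clip_of_le (ε := ε) h with ⟨h1, h2⟩ | ⟨h1, h2⟩
    · rw [h1, add_sub_cancel_left, abs_of_nonneg hε]
    · rw [max_eq_left hε] at h2
      rw [h1, abs_of_nonneg (by linarith)]
      exact h2
  · rcases clip_of_lt (ε := ε) h with ⟨h1, h2⟩ | ⟨h1, h2⟩
    · rw [h1, abs_of_nonpos (by linarith)]; linarith
    · rw [h1, abs_of_nonpos (by linarith)]; linarith

/-- Clipping an `ε`-accurate estimate of `p` is optimistic for `x ↦ - x log x`. -/
theorem negMulLog_le_negMulLog_clip {p r ε : ℝ} (hp : 0 ≤ p) (h : |r - p| ≤ ε) :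
    Real.negMulLog p ≤ Real.negMulLog (clip r ε) := by
  have hε : 0 ≤ ε := (abs_nonneg _).trans h
  rw [abs_le] at h
  have hmax : Real.negMulLog p ≤ Real.negMulLog (Real.exp (-1)) := by
    rcases le_total p (Real.exp (-1)) with h1 | h1
    · exact negMulLog_le_of_le_exp hp h1 le_rfl
    · exact negMulLog_le_of_exp_le h1 le_rfl
  -- Either clipping lands on the maximizer, or it passes p (or reaches it) while staying on one
  -- monotone branch of u.
  rcases le_or_gt r (Real.exp (-1)) with hr | hr
  · rcases clip_of_le (ε := ε) hr with ⟨h1, h2⟩ | ⟨h1, h2⟩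
    · rw [h1]
      exact negMulLog_le_of_le_exp hp (by linarith) h2
    · rwa [h1]
  · rcases clip_of_lt (ε := ε) hr with ⟨h1, h2⟩ | ⟨h1, h2⟩
    · rw [h1]
      exact negMulLog_le_of_exp_le (by linarith) h2
    · rwa [h1]

end Clip

/-! ### Entropy and the Inception score -/

section Score

variable {d : ℕ}

theorem entropy_nonneg {z : Fin d → ℝ} (hz : z ∈ stdSimplex ℝ (Fin d)) : 0 ≤ entropy z :=
  Finset.sum_nonneg fun j _ => Real.negMulLog_nonneg (hz.1 j) (mem_Icc_of_mem_stdSimplex hz j).2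

theorem entropy_le_log {z : Fin d → ℝ} (hd : 1 ≤ d) (hz : z ∈ stdSimplex ℝ (Fin d)) :
    entropy z ≤ Real.log d := by
  have hd' : (0 : ℝ) < d := by exact_mod_cast hd
  calc entropy z ≤ ∑ j, (Real.negMulLog (d : ℝ)⁻¹
        + (-Real.log (d : ℝ)⁻¹ - 1) * (z j - (d : ℝ)⁻¹)) :=
        Finset.sum_le_sum fun j _ => negMulLog_le_tangent (by positivity) (hz.1 j)
    _ = Real.log d := by
        rw [Finset.sum_add_distrib, ← Finset.mul_sum, Finset.sum_sub_distrib, hz.2]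
        simp [Real.negMulLog, hd'.ne']

theorem measurable_entropy : Measurable (entropy : (Fin d → ℝ) → ℝ) :=
  Finset.measurable_sum _ fun j _ =>
    Real.continuous_negMulLog.measurable.comp (measurable_pi_apply j)

variable {𝒳 : Type*} [MeasurableSpace 𝒳] {q : 𝒳 → Fin d → ℝ}

theorem integrable_coord (hq_meas : Measurable q) (hq : ∀ x, q x ∈ stdSimplex ℝ (Fin d))
    (p : Measure 𝒳) [IsProbabilityMeasure p]
    (j : Fin d) : Integrable (fun x => q x j) p :=
  integrable_of_mem_Icc (measurable_pi_iff.1 hq_meas j) fun x => mem_Icc_of_mem_stdSimplex (hq x) j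

theorem marginal_mem_stdSimplex (hq_meas : Measurable q) (hq : ∀ x, q x ∈ stdSimplex ℝ (Fin d))
    (p : Measure 𝒳) [IsProbabilityMeasure p]
    : marginal q p ∈ stdSimplex ℝ (Fin d) := by
  refine ⟨fun j => integral_nonneg fun x => (hq x).1 j, ?_⟩
  simp only [marginal]
  rw [← integral_finsetSum _ fun j _ => integrable_coord hq_meas hq p j]
  simp [fun x => (hq x).2]

theorem ae_eq_zero_of_marginal_eq_zero (hq_meas : Measurable q) (hq : ∀ x, q x ∈ stdSimplex ℝ (Fin d))
    (p : Measure 𝒳) [IsProbabilityMeasure p]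
    {j : Fin d} (hj : marginal q p j = 0) :
    ∀ᵐ x ∂p, q x j = 0 :=
  (integral_eq_zero_iff_of_nonneg (fun x => (hq x).1 j)
    (integrable_coord hq_meas hq p j)).1 hj

/-- The expected divergence is a mutual information. The logarithm of the quotient splits because
almost surely q vanishes wherever the marginal does. -/
theorem integral_kl (hq_meas : Measurable q) (hq : ∀ x, q x ∈ stdSimplex ℝ (Fin d))
    (p : Measure 𝒳) [IsProbabilityMeasure p]
    (hd : 1 ≤ d) :
    ∫ x, kl (q x) (marginal q p) ∂p
      = entropy (marginal q p) - ∫ x, entropy (q x) ∂p := by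
  have hae : ∀ᵐ x ∂p, ∀ j, marginal q p j = 0 → q x j = 0 := by
    rw [ae_all_iff]
    intro j
    by_cases hj : marginal q p j = 0
    · filter_upwards [ae_eq_zero_of_marginal_eq_zero hq_meas hq p hj] with x hx _ using hx
    · exact ae_of_all _ fun x h => absurd h hj
  have h1 : (fun x => kl (q x) (marginal q p))
      =ᵐ[p] fun x => (∑ j, q x j * -Real.log (marginal q p j)) - entropy (q x) := by
    filter_upwards [hae] with x hx
    rw [kl, entropy, ← Finset.sum_sub_distrib]
    refine Finset.sum_congr rfl fun j _ => ?_
    by_cases h0 : q x j = 0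
    · simp [h0]
    · rw [Real.log_div h0 fun h => h0 (hx j h), Real.negMulLog]
      ring
  have hent : Integrable (fun x => entropy (q x)) p :=
    integrable_of_mem_Icc (measurable_entropy.comp hq_meas) fun x =>
      ⟨entropy_nonneg (hq x), entropy_le_log hd (hq x)⟩
  rw [integral_congr_ae h1, integral_sub (integrable_finsetSum _ fun j _ =>
    (integrable_coord hq_meas hq p j).mul_const _) hent, integral_finsetSum _ fun j _ =>
    (integrable_coord hq_meas hq p j).mul_const _]
  congr 1
  refine Finset.sum_congr rfl fun j _ => ?_
  rw [integral_mul_const, Real.negMulLog, ← marginal]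
  ring

theorem inceptionScore_eq (hq_meas : Measurable q) (hq : ∀ x, q x ∈ stdSimplex ℝ (Fin d))
    (p : Measure 𝒳) [IsProbabilityMeasure p]
    (hd : 1 ≤ d) :
    inceptionScore q p = Real.exp (entropy (marginal q p) - ∫ x, entropy (q x) ∂p) := by
  rw [inceptionScore, integral_kl hq_meas hq p hd]

theorem inceptionScore_le (hq_meas : Measurable q) (hq : ∀ x, q x ∈ stdSimplex ℝ (Fin d))
    (p : Measure 𝒳) [IsProbabilityMeasure p]
    (hd : 1 ≤ d) : inceptionScore q p ≤ d := by
  have hd' : (0 : ℝ) < d := by exact_mod_cast hd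
  rw [inceptionScore_eq hq_meas hq p hd, ← Real.le_log_iff_exp_le hd']
  have h1 := entropy_le_log hd (marginal_mem_stdSimplex hq_meas hq p)
  have h2 : 0 ≤ ∫ x, entropy (q x) ∂p := integral_nonneg fun x => entropy_nonneg (hq x)
  linarith

/-- For x ≤ 1, e^x - 1 ≤ 2x; for x ≥ 1 the bound A ≤ D is enough. Thus the sample size need not be
large for the exponent to be linearized. -/
theorem exp_sub_exp_le {A c x D : ℝ} (hx : 0 ≤ x) (hA : A ≤ D) (hc : Real.exp c ≤ D)
    (hAx : A ≤ Real.exp (c + x)) : A - Real.exp c ≤ 2 * D * x := by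
  have hc0 := Real.exp_pos c
  rcases le_total x 1 with h | h
  · have h1 : Real.exp x - 1 ≤ 2 * x := by
      have := (abs_le.1 (Real.abs_exp_sub_one_sub_id_le (x := x) (by rwa [abs_of_nonneg hx]))).2
      nlinarith
    rw [Real.exp_add] at hAx
    nlinarith [mul_le_mul_of_nonneg_left h1 hc0.le, mul_le_mul_of_nonneg_right hc hx]
  · nlinarith

end Score

/-! ### Optimism of the score and the size of its excess -/

section Optimism

variable {𝒳 : Type*} {d : ℕ} {q : 𝒳 → Fin d → ℝ}

theorem sampleMean_mem_Icc {z : ℕ → ℝ} {R : ℝ} (hz : ∀ i, z i ∈ Set.Icc 0 R) {n : ℕ}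
    (hn : 0 < n) : sampleMean z n ∈ Set.Icc 0 R := by
  have hn' : (0 : ℝ) < n := by exact_mod_cast hn
  refine ⟨div_nonneg (Finset.sum_nonneg fun i _ => (hz i).1) hn'.le, ?_⟩
  rw [sampleMean, div_le_iff₀ hn']
  calc _ ≤ ∑ i ∈ Finset.range n, R := Finset.sum_le_sum fun i _ => (hz i).2
    _ = _ := by simp [mul_comm]

/-- The mean entropy enters the score with a minus sign, so only an upper deviation of its estimate
could destroy optimism. -/
theorem le_optimisticIS {P : Fin d → ℝ} (hP : ∀ j, 0 ≤ P j) {H δ : ℝ} {x : ℕ → 𝒳} {n : ℕ}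
    (hcls : ∀ j, |sampleMean (fun i => q (x i) j) n - P j|
      ≤ bernsteinRadius (Real.log (4 * d / δ)) 1 (fun i => q (x i) j) n)
    (hent : sampleMean (fun i => entropy (q (x i))) n - H
      ≤ bernsteinRadius (Real.log (4 * d / δ)) (Real.log d) (fun i => entropy (q (x i))) n) :
    ((Real.exp (entropy P - H) : ℝ) : EReal) ≤ optimisticIS q δ x n := by
  rw [optimisticIS]
  split_ifs with h
  · exact le_top
  · rw [EReal.coe_le_coe_iff, Real.exp_le_exp]
    have : entropy P ≤ entropy (optimisticMarginal q δ x n) :=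
      Finset.sum_le_sum fun j _ => negMulLog_le_negMulLog_clip (hP j) (hcls j)
    rw [radius_eq_bernsteinRadius]
    linarith

/-- The clipped estimate is within 3r + r of P, the tangent slope is at most m in absolute value,
and r ≤ 6L/√n. -/
theorem negMulLog_clip_le_of_pos {P m L r : ℝ} (hP : 0 < P) (hm : |-Real.log P - 1| ≤ m)
    (hL : 1 ≤ L) {z : ℕ → ℝ} (hz : ∀ i, z i ∈ Set.Icc (0 : ℝ) 1) {n : ℕ} (hn : 2 ≤ n)
    (hr : r = bernsteinRadius L 1 z n) (hcls : |sampleMean z n - P| ≤ 3 * r) :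
    Real.negMulLog (clip (sampleMean z n) r) ≤ Real.negMulLog P + 24 * m * L / Real.sqrt n := by
  have hr0 : 0 ≤ r := hr ▸ bernsteinRadius_nonneg (by linarith) zero_le_one z hn
  have hclip := clip_mem_Icc hr0 (sampleMean_mem_Icc hz (by omega : 0 < n))
  have h1 := negMulLog_le_tangent hP hclip.1
  have h2 : |clip (sampleMean z n) r - P| ≤ 4 * r := by
    have h3 := abs_clip_sub_le (p := sampleMean z n) hr0
    rw [abs_le] at h3 hcls ⊢
    constructor <;> linarith [h3.1, h3.2, hcls.1, hcls.2]
  have h4 : r ≤ 6 * 1 * L / Real.sqrt n := hr ▸ bernsteinRadius_le hL hz hn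
  have h5 : (-Real.log P - 1) * (clip (sampleMean z n) r - P) ≤ m * (4 * r) := by
    refine (le_abs_self _).trans ?_
    rw [abs_mul]
    exact mul_le_mul hm h2 (abs_nonneg _) ((abs_nonneg _).trans hm)
  have h6 : m * (4 * r) ≤ m * (4 * (6 * 1 * L / Real.sqrt n)) := by
    have := (abs_nonneg _).trans hm
    gcongr
  have h7 : m * (4 * (6 * 1 * L / Real.sqrt n)) = 24 * m * L / Real.sqrt n := by ring
  linarith

/-- With vanishing samples the variance term disappears and the radius is O(L/n); the square root
bound of u turns this into O(L/√n). -/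
theorem negMulLog_clip_le_of_zero {L : ℝ} (hL : 1 ≤ L) {z : ℕ → ℝ} (hz : ∀ i, z i = 0) {n : ℕ}
    (hn : 2 ≤ n) :
    Real.negMulLog (clip (sampleMean z n) (bernsteinRadius L 1 z n)) ≤ 5 * L / Real.sqrt n := by
  have hn' : (0 : ℝ) < n := by positivity
  have hr0 : 0 ≤ bernsteinRadius L 1 z n :=
    bernsteinRadius_nonneg (by linarith) zero_le_one z hn
  have hmean : sampleMean z n = 0 := by simp [sampleMean, hz]
  have hvar : sampleVar z n = 0 := by simp [sampleVar, hz]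
  have hr : bernsteinRadius L 1 z n ≤ 5 * 1 * L / n := by
    rw [bernsteinRadius, hvar]
    simpa using const_div_le zero_le_one (by linarith : 0 ≤ L) hn
  have hclip := clip_mem_Icc hr0 (p := sampleMean z n) (by rw [hmean]; simp)
  have h1 := abs_clip_sub_le (p := sampleMean z n) hr0
  rw [hmean, sub_zero] at h1
  rw [hmean] at hclip ⊢
  have h2 : clip 0 (bernsteinRadius L 1 z n) ≤ 5 * L / n := by
    linarith [le_abs_self (clip 0 (bernsteinRadius L 1 z n))]
  refine (negMulLog_le_two_mul_sqrt hclip.1).trans ?_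
  have h3 : Real.sqrt (clip 0 (bernsteinRadius L 1 z n)) ≤ 5 / 2 * L / Real.sqrt n := by
    rw [Real.sqrt_le_left (by positivity), div_pow, Real.sq_sqrt hn'.le]
    refine h2.trans ?_
    gcongr
    nlinarith
  calc _ ≤ 2 * (5 / 2 * L / Real.sqrt n) := by gcongr
    _ = _ := by ring

/-- The exponent of the optimistic score exceeds the true one by a multiple of `1 / √n`. -/
theorem optimistic_exponent_le (hd : 1 ≤ d) (hq : ∀ x, q x ∈ stdSimplex ℝ (Fin d))
    {P : Fin d → ℝ} (hP : ∀ j, 0 ≤ P j) {m : ℝ} (hm0 : 0 ≤ m)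
    (hm : ∀ j, 0 < P j → |-Real.log (P j) - 1| ≤ m) {H δ L : ℝ} (hLdef : L = Real.log (4 * d / δ))
    (hL : 1 ≤ L) {x : ℕ → 𝒳} {n : ℕ} (hn : 2 ≤ n)
    (hcls : ∀ j, |sampleMean (fun i => q (x i) j) n - P j|
      ≤ bernsteinRadius (3 * L) 1 (fun i => q (x i) j) n)
    (hent : |sampleMean (fun i => entropy (q (x i))) n - H|
      ≤ bernsteinRadius (3 * L) (Real.log d) (fun i => entropy (q (x i))) n)
    (hzero : ∀ j, P j = 0 → ∀ i, q (x i) j = 0) :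
    entropy (optimisticMarginal q δ x n) - sampleMean (fun i => entropy (q (x i))) n
        + radius d δ (Real.log d) (fun i => entropy (q (x i))) n
      ≤ entropy P - H + (24 * d * m + 5 * d + 24 * Real.log d) * L / Real.sqrt n := by
  have hL0 : 0 ≤ L := by linarith
  have hs : 0 ≤ Real.sqrt n := Real.sqrt_nonneg _
  have h1 : entropy (optimisticMarginal q δ x n)
      ≤ ∑ j, (Real.negMulLog (P j) + (24 * m * L / Real.sqrt n + 5 * L / Real.sqrt n)) := by
    refine Finset.sum_le_sum fun j _ => ?_
    rw [optimisticMarginal, radius_eq_bernsteinRadius, ← hLdef]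
    rcases (hP j).eq_or_lt with h0 | h0
    · refine (negMulLog_clip_le_of_zero hL (hzero j h0.symm) hn).trans ?_
      rw [← h0, Real.negMulLog_zero]
      have : 0 ≤ 24 * m * L / Real.sqrt n := by positivity
      linarith
    · have := negMulLog_clip_le_of_pos h0 (hm j h0) hL
        (fun i => mem_Icc_of_mem_stdSimplex (hq (x i)) j) hn rfl
        ((hcls j).trans (bernsteinRadius_three_mul_le hL0 _ _))
      have h5 : 0 ≤ 5 * L / Real.sqrt n := by positivity
      linarith
  have h2 := hent.trans (bernsteinRadius_three_mul_le hL0 _ _)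
  have h3 := bernsteinRadius_le hL (fun i => (⟨entropy_nonneg (hq (x i)),
    entropy_le_log hd (hq (x i))⟩ : entropy (q (x i)) ∈ Set.Icc 0 (Real.log d))) hn
  have h4 : ∑ j, (Real.negMulLog (P j) + (24 * m * L / Real.sqrt n + 5 * L / Real.sqrt n))
      = entropy P + d * (24 * m * L / Real.sqrt n + 5 * L / Real.sqrt n) := by
    rw [Finset.sum_add_distrib, Finset.sum_const, Finset.card_univ, Fintype.card_fin,
      nsmul_eq_mul, entropy]
  -- The entropy part is four radii of size 6 log d · L/√n: three for the accuracy of the estimate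
  -- and one for the bonus.
  have h5 : (24 * d * m + 5 * d + 24 * Real.log d) * L / Real.sqrt n
      = d * (24 * m * L / Real.sqrt n + 5 * L / Real.sqrt n)
        + 4 * (6 * Real.log d * L / Real.sqrt n) := by ring
  rw [radius_eq_bernsteinRadius, ← hLdef, h5]
  rw [abs_le] at h2
  linarith [h2.1]

end Optimism

/-! ### Sums over visit counts -/

section Counting

variable {G : ℕ}

theorem visits_succ (a : ℕ → Fin G) (T : ℕ) (g : Fin G) :
    visits a (T + 1) g = visits a T g + if a T = g then 1 else 0 := by
  rw [visits, visits, Finset.range_add_one, Finset.filter_insert]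
  split_ifs with h
  · rw [Finset.card_insert_of_notMem (by simp)]
  · simp

theorem visits_le (a : ℕ → Fin G) (t : ℕ) (g : Fin G) : visits a t g ≤ t :=
  (Finset.card_filter_le _ _).trans (by simp)

/-- Grouping the steps by picked model, the count seen at successive picks of g runs through 0, 1,
2, …. -/
theorem sum_visits (a : ℕ → Fin G) (w : ℕ → ℝ) (T : ℕ) :
    ∑ t ∈ Finset.range T, w (visits a t (a t))
      = ∑ g, ∑ v ∈ Finset.range (visits a T g), w v := by
  induction T with
  | zero => simp [visits]
  | succ T ih =>
    rw [Finset.sum_range_succ, ih]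
    have h : ∀ g, ∑ v ∈ Finset.range (visits a (T + 1) g), w v
        = ∑ v ∈ Finset.range (visits a T g), w v
          + if a T = g then w (visits a T g) else 0 := by
      intro g
      rw [visits_succ]
      split_ifs
      · rw [Finset.sum_range_succ]
      · simp
    simp only [h, Finset.sum_add_distrib, Finset.sum_ite_eq, Finset.mem_univ, if_true]

theorem sum_inv_sqrt_succ_le (N : ℕ) :
    ∑ v ∈ Finset.range N, 1 / Real.sqrt (v + 1) ≤ 2 * Real.sqrt N := by
  induction N with
  | zero => simp
  | succ N ih =>
    rw [Finset.sum_range_succ]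
    push_cast
    have h1 : 0 < Real.sqrt (N + 1) := Real.sqrt_pos.2 (by positivity)
    have h2 := Real.mul_self_sqrt (show (0 : ℝ) ≤ N + 1 by positivity)
    have h3 := Real.mul_self_sqrt (show (0 : ℝ) ≤ N by positivity)
    have h4 : 1 / Real.sqrt (N + 1) ≤ 2 * Real.sqrt (N + 1) - 2 * Real.sqrt N := by
      rw [div_le_iff₀ h1]
      nlinarith [sq_nonneg (Real.sqrt (N + 1) - Real.sqrt N)]
    linarith

/-- Each model contributes at most 2√(visits); Cauchy–Schwarz applies because the visits add up to
T. -/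
theorem sum_inv_sqrt_visits_le (a : ℕ → Fin G) (T : ℕ) :
    ∑ t ∈ Finset.range T, 1 / Real.sqrt (visits a t (a t) + 1)
      ≤ 2 * (Real.sqrt G * Real.sqrt T) := by
  have hcount : ∑ g, (visits a T g : ℝ) = T := by
    have := sum_visits a (fun _ => 1) T
    simpa using this.symm
  rw [sum_visits a (fun v => 1 / Real.sqrt (v + 1))]
  calc _ ≤ ∑ g, 2 * Real.sqrt (visits a T g) :=
        Finset.sum_le_sum fun g _ => sum_inv_sqrt_succ_le _
    _ = 2 * ∑ g, Real.sqrt (visits a T g) := by rw [Finset.mul_sum]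
    _ ≤ 2 * (Real.sqrt G * Real.sqrt T) := by
        gcongr
        rw [← Real.sqrt_mul (by positivity)]
        apply Real.le_sqrt_of_sq_le
        have h := sq_sum_le_card_mul_sum_sq (s := (Finset.univ : Finset (Fin G)))
          (f := fun g => Real.sqrt (visits a T g))
        simpa [Real.sq_sqrt, hcount] using h

end Counting

/-! ### Regret on the good event -/

section Deterministic

variable {𝒳 : Type*} [MeasurableSpace 𝒳] {d G : ℕ} {q : 𝒳 → Fin d → ℝ} {p : Fin G → Measure 𝒳}

theorem slope_nonneg : 0 ≤ slope q p :=
  Real.sSup_nonneg (by rintro r ⟨g, j, -, rfl⟩; exact abs_nonneg _)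

theorem abs_le_slope {g : Fin G} {j : Fin d} (h : 0 < marginal q (p g) j) :
    |-Real.log (marginal q (p g) j) - 1| ≤ slope q p := by
  refine le_csSup ?_ ⟨g, j, h, by rw [Real.deriv_negMulLog h.ne']⟩
  refine (Set.Finite.subset (Set.finite_range fun s : Fin G × Fin d =>
    |deriv Real.negMulLog (marginal q (p s.1) s.2)|) ?_).bddAbove
  rintro r ⟨g, j, -, rfl⟩
  exact ⟨(g, j), rfl⟩

theorem iSup_inceptionScore_le [∀ g, IsProbabilityMeasure (p g)] (hq_meas : Measurable q)
    (hq : ∀ x, q x ∈ stdSimplex ℝ (Fin d)) (hd : 1 ≤ d) (hG : 1 ≤ G) :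
    ⨆ g, inceptionScore q (p g) ≤ d := by
  have : Nonempty (Fin G) := ⟨⟨0, hG⟩⟩
  exact ciSup_le fun g => inceptionScore_le hq_meas hq (p g) hd

theorem inceptionScore_eq_one [∀ g, IsProbabilityMeasure (p g)] (hq_meas : Measurable q)
    (hq : ∀ x, q x ∈ stdSimplex ℝ (Fin d)) (hd : d = 1) (g : Fin G) :
    inceptionScore q (p g) = 1 := by
  have hent : ∀ z ∈ stdSimplex ℝ (Fin d), entropy z = 0 := fun z hz => by
    have h1 := entropy_le_log hd.ge hz
    exact le_antisymm (by simpa [hd] using h1) (entropy_nonneg hz)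
  rw [inceptionScore_eq hq_meas hq (p g) hd.ge,
    hent _ (marginal_mem_stdSimplex hq_meas hq (p g))]
  simp [fun x => hent _ (hq x)]

theorem five_eighths_le_log {d : ℕ} (hd : 2 ≤ d) : (5 : ℝ) / 8 ≤ Real.log d := by
  have h1 : Real.log 2 ≤ Real.log d :=
    Real.log_le_log two_pos (by exact_mod_cast hd)
  linarith [Real.log_two_gt_d9]

/-- The estimates for one model are accurate enough for its score to be optimistic. -/
def Optimistic (q : 𝒳 → Fin d → ℝ) (p : Measure 𝒳) (x : ℕ → 𝒳) (L : ℝ) (n : ℕ) : Prop :=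
  2 ≤ n → (∀ j, |sampleMean (fun i => q (x i) j) n - marginal q p j|
      ≤ bernsteinRadius L 1 (fun i => q (x i) j) n) ∧
    sampleMean (fun i => entropy (q (x i))) n - ∫ y, entropy (q y) ∂p
      ≤ bernsteinRadius L (Real.log d) (fun i => entropy (q (x i))) n

/-- All the estimates for one model are accurate, on both sides. -/
def Accurate (q : 𝒳 → Fin d → ℝ) (p : Measure 𝒳) (x : ℕ → 𝒳) (L : ℝ) (n : ℕ) : Prop :=
  2 ≤ n → (∀ j, |sampleMean (fun i => q (x i) j) n - marginal q p j|
      ≤ bernsteinRadius L 1 (fun i => q (x i) j) n) ∧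
    |sampleMean (fun i => entropy (q (x i))) n - ∫ y, entropy (q y) ∂p|
      ≤ bernsteinRadius L (Real.log d) (fun i => entropy (q (x i))) n

variable {δ L : ℝ} {b T : ℕ} {x : Fin G → ℕ → 𝒳}

theorem natCast_le_coefficient {L m : ℝ} (hd : 2 ≤ d) (hL : 1 ≤ L) (hm : 0 ≤ m) :
    (d : ℝ) ≤ 64 * d ^ 2 * L * (d * m + Real.log d) := by
  have hdr : (2 : ℝ) ≤ d := by exact_mod_cast hd
  have hlog := five_eighths_le_log hd
  have hW : (5 : ℝ) / 8 ≤ d * m + Real.log d := by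
    have : 0 ≤ d * m := by positivity
    linarith
  have h1 : (1 : ℝ) ≤ 64 * d * L * (d * m + Real.log d) := by
    calc (1 : ℝ) ≤ 64 * 2 * 1 * (5 / 8) := by norm_num
      _ ≤ 64 * d * L * (d * m + Real.log d) := by gcongr
  calc (d : ℝ) = d * 1 := by ring
    _ ≤ d * (64 * d * L * (d * m + Real.log d)) := by gcongr
    _ = _ := by ring

/-- The bare term 5d is absorbed by 8 d log d, since log d ≥ 5/8 for d ≥ 2; this costs an extra
factor d. -/
theorem width_le_coefficient {L m : ℝ} (hd : 2 ≤ d) (hL : 1 ≤ L) (hm : 0 ≤ m) :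
    2 * (d : ℝ) * ((24 * d * m + 5 * d + 24 * Real.log d) * L)
      ≤ 64 * d ^ 2 * L * (d * m + Real.log d) := by
  have hdr : (2 : ℝ) ≤ d := by exact_mod_cast hd
  have hlog := five_eighths_le_log hd
  have h3 : 5 * (d : ℝ) ≤ 8 * (d * Real.log d) := by nlinarith
  have h4 : Real.log d ≤ d * Real.log d := by nlinarith
  have h5 : (d : ℝ) * m ≤ d * (d * m) := by
    have : 0 ≤ d * m := by positivity
    nlinarith
  have h2 : 24 * d * m + 5 * d + 24 * Real.log d ≤ 32 * d * (d * m + Real.log d) := by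
    have h6 : 0 ≤ d * (d * m) := by positivity
    linarith
  calc _ ≤ 2 * (d : ℝ) * ((32 * d * (d * m + Real.log d)) * L) := by gcongr
    _ = _ := by ring

/-- The UCB chain: the best score is below its optimistic value, which is below that of the picked
model, which exceeds the true score of that model by O(1/√n). -/
theorem step_regret_le [∀ g, IsProbabilityMeasure (p g)] (hq_meas : Measurable q)
    (hq : ∀ x, q x ∈ stdSimplex ℝ (Fin d))
    (hd : 2 ≤ d) (hb : 1 ≤ b) (hL : 1 ≤ L) (hLdef : L = Real.log (4 * d / (δ / T)))
    {a : ℕ → Fin G} (hrun : IsRun q δ b T x a) {gs : Fin G}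
    (hopt : ∀ v ∈ Finset.Ico 1 T, Optimistic q (p gs) (x gs) L (b * v))
    (hacc : ∀ g, ∀ v ∈ Finset.Ico 1 T, Accurate q (p g) (x g) (3 * L) (b * v))
    (hzero : ∀ g i j, marginal q (p g) j = 0 → q (x g i) j = 0) {t : ℕ} (ht : t < T) :
    inceptionScore q (p gs) - inceptionScore q (p (a t))
      ≤ 128 * d ^ 2 * L * (d * slope q p + Real.log d) * (1 / Real.sqrt (visits a t (a t) + 1)) := by
  have hd1 : 1 ≤ d := by omega
  have hlog := five_eighths_le_log hd
  have hm : 0 ≤ slope q p := slope_nonneg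
  set m := slope q p with hmdef
  set W : ℝ := d * m + Real.log d with hW
  set D : ℝ := 64 * d ^ 2 * L * W with hD
  have hdD : (d : ℝ) ≤ D := natCast_le_coefficient hd hL hm
  set g := a t with hg
  set v := visits a t g with hv
  have hvT : v < T := (visits_le a t g).trans_lt ht
  have hgoal : 128 * d ^ 2 * L * W * (1 / Real.sqrt (v + 1)) = 2 * D / Real.sqrt (v + 1) := by
    rw [hD]; ring
  rw [hgoal]
  have hs1 : 0 < Real.sqrt ((v : ℝ) + 1) := Real.sqrt_pos.2 (by positivity)
  have hISs := inceptionScore_le hq_meas hq (p gs) hd1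
  have hISg := inceptionScore_le hq_meas hq (p g) hd1
  -- With fewer than two samples the picked score is ∞ and carries no information; then v ≤ 1 and
  -- the trivial bound d suffices.
  rcases Nat.lt_or_ge (b * v) 2 with hn | hn
  · have hv1 : v ≤ 1 := by nlinarith
    have h2 : Real.sqrt ((v : ℝ) + 1) ≤ 2 := by
      have : (v : ℝ) ≤ 1 := by exact_mod_cast hv1
      rw [Real.sqrt_le_left (by norm_num)]
      linarith
    have h0 : 0 < inceptionScore q (p g) := Real.exp_pos _
    rw [le_div_iff₀ hs1]
    have h3 : inceptionScore q (p gs) - inceptionScore q (p g) ≤ D := by linarith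
    calc _ ≤ D * Real.sqrt ((v : ℝ) + 1) := by gcongr
      _ ≤ D * 2 := by gcongr
      _ = _ := by ring
  have hv1 : 1 ≤ v := by
    by_contra h
    have : v = 0 := by omega
    rw [this] at hn
    omega
  have hle : ((inceptionScore q (p gs) : ℝ) : EReal) ≤ optimisticIS q (δ / T) (x g) (b * v) := by
    refine le_trans ?_ (hrun t ht gs)
    set n := b * visits a t gs with hnn
    rcases Nat.lt_or_ge n 2 with hns | hns
    · rw [optimisticIS, if_pos (by omega)]
      exact le_top
    · have hmem : visits a t gs ∈ Finset.Ico 1 T := by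
        rw [Finset.mem_Ico]
        refine ⟨?_, (visits_le a t gs).trans_lt ht⟩
        by_contra h
        have : visits a t gs = 0 := by omega
        rw [hnn, this] at hns
        omega
      have := hopt _ hmem hns
      rw [hLdef] at this
      rw [inceptionScore_eq hq_meas hq (p gs) hd1]
      exact le_optimisticIS (marginal_mem_stdSimplex hq_meas hq (p gs)).1 this.1 this.2
  have hac := hacc g v (Finset.mem_Ico.2 ⟨hv1, hvT⟩) hn
  have hexp := optimistic_exponent_le hd1 hq (marginal_mem_stdSimplex hq_meas hq (p g)).1 hm
    (fun j hj => abs_le_slope hj) hLdef hL hn hac.1 hac.2 (fun j hj i => hzero g i j hj)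
  rw [optimisticIS, if_neg (by omega), EReal.coe_le_coe_iff] at hle
  have hle' := hle.trans (Real.exp_le_exp.2 hexp)
  rw [inceptionScore_eq hq_meas hq (p g) hd1] at hISg ⊢
  have hn0 : (0 : ℝ) < ((b * v : ℕ) : ℝ) := by
    have : 0 < b * v := by omega
    exact_mod_cast this
  have hsn : 0 < Real.sqrt ((b * v : ℕ) : ℝ) := Real.sqrt_pos.2 hn0
  refine (exp_sub_exp_le (by positivity) hISs hISg hle').trans ?_
  have h1 : 2 * (d : ℝ) * ((24 * d * m + 5 * d + 24 * Real.log d) * L) ≤ D :=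
    width_le_coefficient hd hL hm
  -- For v ≥ 1 and b ≥ 1, v + 1 ≤ 4bv; so the bound holds uniformly in the batch size.
  have h6 : Real.sqrt ((v : ℝ) + 1) ≤ 2 * Real.sqrt ((b * v : ℕ) : ℝ) := by
    rw [Real.sqrt_le_left (by positivity), mul_pow, Real.sq_sqrt hn0.le]
    have : v + 1 ≤ 2 ^ 2 * (b * v) := by nlinarith
    exact_mod_cast this
  calc _ = 2 * (d : ℝ) * ((24 * d * m + 5 * d + 24 * Real.log d) * L)
          / Real.sqrt ((b * v : ℕ) : ℝ) := by ring
    _ ≤ D / Real.sqrt ((b * v : ℕ) : ℝ) := by gcongr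
    _ ≤ 2 * D / Real.sqrt ((v : ℝ) + 1) := by
        rw [div_le_div_iff₀ hsn hs1]
        have hD0 : 0 ≤ D := by linarith
        nlinarith [mul_le_mul_of_nonneg_left h6 hD0]

/-- The regret on the event where all estimates are accurate. -/
theorem regret_le_of_accurate [∀ g, IsProbabilityMeasure (p g)] (hq_meas : Measurable q)
    (hq : ∀ x, q x ∈ stdSimplex ℝ (Fin d))
    (hd : 2 ≤ d) (hb : 1 ≤ b) (hL : 1 ≤ L) (hLdef : L = Real.log (4 * d / (δ / T)))
    {a : ℕ → Fin G} (hrun : IsRun q δ b T x a) {gs : Fin G}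
    (hgs : ⨆ g, inceptionScore q (p g) = inceptionScore q (p gs))
    (hopt : ∀ v ∈ Finset.Ico 1 T, Optimistic q (p gs) (x gs) L (b * v))
    (hacc : ∀ g, ∀ v ∈ Finset.Ico 1 T, Accurate q (p g) (x g) (3 * L) (b * v))
    (hzero : ∀ g i j, marginal q (p g) j = 0 → q (x g i) j = 0) :
    regret q p T a
      ≤ 256 * d ^ 2 * L * (d * slope q p + Real.log d) * (Real.sqrt G * Real.sqrt T) := by
  have hm : 0 ≤ slope q p := slope_nonneg
  have hlog : 0 ≤ Real.log d := Real.log_natCast_nonneg d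
  rw [regret, hgs]
  calc _ ≤ ∑ t ∈ Finset.range T, 128 * d ^ 2 * L * (d * slope q p + Real.log d)
        * (1 / Real.sqrt (visits a t (a t) + 1)) :=
        Finset.sum_le_sum fun t ht => step_regret_le hq_meas hq hd hb hL hLdef hrun hopt hacc
          hzero (Finset.mem_range.1 ht)
    _ ≤ 128 * d ^ 2 * L * (d * slope q p + Real.log d) * (2 * (Real.sqrt G * Real.sqrt T)) := by
        rw [← Finset.mul_sum]
        gcongr
        exact sum_inv_sqrt_visits_le a T
    _ = _ := by ring

/-- With fewer steps than models the bound holds trivially. -/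
theorem regret_le_of_le [∀ g, IsProbabilityMeasure (p g)] (hq_meas : Measurable q)
    (hq : ∀ x, q x ∈ stdSimplex ℝ (Fin d))
    (hd : 2 ≤ d) (hG : 1 ≤ G) (hTG : T ≤ G) (hL : 1 ≤ L) (a : ℕ → Fin G) :
    regret q p T a
      ≤ 256 * d ^ 2 * L * (d * slope q p + Real.log d) * (Real.sqrt G * Real.sqrt T) := by
  have hm : 0 ≤ slope q p := slope_nonneg
  have hdr : (2 : ℝ) ≤ d := by exact_mod_cast hd
  have hlog := five_eighths_le_log hd
  have h1 : (T : ℝ) ≤ Real.sqrt G * Real.sqrt T := by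
    have hT : Real.sqrt T * Real.sqrt T = T := Real.mul_self_sqrt (by positivity)
    have : Real.sqrt T ≤ Real.sqrt G := Real.sqrt_le_sqrt (by exact_mod_cast hTG)
    calc (T : ℝ) = Real.sqrt T * Real.sqrt T := hT.symm
      _ ≤ _ := by gcongr
  have h2 : (d : ℝ) ≤ 256 * d ^ 2 * L * (d * slope q p + Real.log d) := by
    have h3 : (1 : ℝ) ≤ 256 * d * L * (d * slope q p + Real.log d) := by
      have : (5 : ℝ) / 8 ≤ d * slope q p + Real.log d := by
        have : 0 ≤ d * slope q p := by positivity
        linarith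
      calc (1 : ℝ) ≤ 256 * 2 * 1 * (5 / 8) := by norm_num
        _ ≤ _ := by gcongr
    calc (d : ℝ) = d * 1 := by ring
      _ ≤ d * (256 * d * L * (d * slope q p + Real.log d)) := by gcongr
      _ = _ := by ring
  calc regret q p T a ≤ ∑ _t ∈ Finset.range T, (d : ℝ) := by
        refine Finset.sum_le_sum fun t _ => ?_
        have h3 := iSup_inceptionScore_le (p := p) hq_meas hq (by omega) hG
        have h4 : 0 < inceptionScore q (p (a t)) := Real.exp_pos _
        linarith
    _ = d * T := by simp [mul_comm]
    _ ≤ _ := by gcongr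

/-- Here √G = e^{log G / 2} and d² ≤ e^{2d} ≤ e^{256d}, so e^C pays for d²√G. -/
theorem bound_le (hd : 2 ≤ d) (hT : 1 ≤ T) (hG : 1 ≤ G) (hL : 1 ≤ L) :
    256 * d ^ 2 * L * (d * slope q p + Real.log d) * (Real.sqrt G * Real.sqrt T)
      ≤ 256 * L ^ 1 * (G * (gap q p ^ 2)⁻¹ * Real.log d
        + Real.exp (256 * d + Real.log G / 2) *
          ((d * slope q p + Real.log d) * Real.sqrt T + Real.log T)) := by
  have hm : 0 ≤ slope q p := slope_nonneg
  have hlog : 0 ≤ Real.log d := Real.log_natCast_nonneg d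
  have hlogT : 0 ≤ Real.log T := Real.log_natCast_nonneg T
  have hG0 : (0 : ℝ) < G := by exact_mod_cast hG
  have h1 : Real.exp (Real.log G / 2) = Real.sqrt G := by
    rw [← Real.log_sqrt hG0.le, Real.exp_log (Real.sqrt_pos.2 hG0)]
  have h2 : (d : ℝ) ^ 2 ≤ Real.exp (256 * d) := by
    have h3 : (d : ℝ) ≤ Real.exp d := by linarith [Real.add_one_le_exp (d : ℝ)]
    calc (d : ℝ) ^ 2 ≤ Real.exp d ^ 2 := by gcongr
      _ = Real.exp (2 * d) := by rw [← Real.exp_nat_mul]; norm_num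
      _ ≤ _ := by gcongr; norm_num
  have h4 : 0 ≤ G * (gap q p ^ 2)⁻¹ * Real.log d := by positivity
  rw [Real.exp_add, h1, pow_one]
  calc _ = 256 * L * (0 + d ^ 2 * Real.sqrt G
        * ((d * slope q p + Real.log d) * Real.sqrt T + 0)) := by ring
    _ ≤ _ := by gcongr

end Deterministic

/-! ### Probability of the bad events -/

section Probability

variable {𝒳 : Type*} [MeasurableSpace 𝒳] {d G : ℕ} {q : 𝒳 → Fin d → ℝ} {p : Measure 𝒳}
  {Ω : Type*} [MeasurableSpace Ω] {μ : Measure Ω} {Y : ℕ → Ω → 𝒳}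

theorem measure_not_class_le [IsProbabilityMeasure μ] (hY : ∀ i, Measurable (Y i))
    (hlaw : ∀ i, μ.map (Y i) = p)
    (hind : iIndepFun Y μ) (hq_meas : Measurable q) (hq : ∀ x, q x ∈ stdSimplex ℝ (Fin d))
    {n : ℕ} (hn : 2 ≤ n) {L : ℝ} (hL : 0 < L) :
    μ.real (⋃ j ∈ Finset.univ, {ω | ¬ |sampleMean (fun i => q (Y i ω) j) n - marginal q p j|
      ≤ bernsteinRadius L 1 (fun i => q (Y i ω) j) n}) ≤ d * (3 * Real.exp (-L)) := by
  refine (measureReal_biUnion_finset_le _ _).trans ?_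
  calc _ ≤ ∑ _j : Fin d, 3 * Real.exp (-L) := by
        refine Finset.sum_le_sum fun j _ => ?_
        have hf : Measurable fun x => q x j := measurable_pi_iff.1 hq_meas j
        refine empirical_bernstein (fun i => hf.comp (hY i)) one_pos
          (fun i ω => mem_Icc_of_mem_stdSimplex (hq (Y i ω)) j)
          (hind.comp (fun _ x => q x j) fun _ => hf) (V := Var[fun x => q x j; p])
          (fun i => ?_) (fun i => ?_) hn hL
        · rw [marginal, ← hlaw i, integral_map (hY i).aemeasurable hf.aestronglyMeasurable]
          rfl
        · rw [← hlaw i, variance_map hf.aemeasurable (hY i).aemeasurable]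
    _ = _ := by simp

theorem entropy_sample_facts (hY : ∀ i, Measurable (Y i)) (hlaw : ∀ i, μ.map (Y i) = p)
    (hind : iIndepFun Y μ) (hq_meas : Measurable q) (hq : ∀ x, q x ∈ stdSimplex ℝ (Fin d))
    (hd : 1 ≤ d) :
    (∀ i, Measurable fun ω => entropy (q (Y i ω))) ∧
      (∀ i ω, entropy (q (Y i ω)) ∈ Set.Icc 0 (Real.log d)) ∧
      iIndepFun (fun i ω => entropy (q (Y i ω))) μ ∧
      (∀ i, ∫ ω, entropy (q (Y i ω)) ∂μ = ∫ x, entropy (q x) ∂p) ∧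
      ∀ i, Var[fun ω => entropy (q (Y i ω)); μ] = Var[fun x => entropy (q x); p] := by
  have hf : Measurable fun x => entropy (q x) := measurable_entropy.comp hq_meas
  refine ⟨fun i => hf.comp (hY i), fun i ω => ⟨entropy_nonneg (hq _), entropy_le_log hd (hq _)⟩,
    hind.comp (fun _ x => entropy (q x)) fun _ => hf, fun i => ?_, fun i => ?_⟩
  · rw [← hlaw i, integral_map (hY i).aemeasurable hf.aestronglyMeasurable]
  · rw [← hlaw i, variance_map hf.aemeasurable (hY i).aemeasurable]
    rfl

theorem measure_not_optimistic_le [IsProbabilityMeasure μ] (hY : ∀ i, Measurable (Y i))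
    (hlaw : ∀ i, μ.map (Y i) = p)
    (hind : iIndepFun Y μ) (hq_meas : Measurable q) (hq : ∀ x, q x ∈ stdSimplex ℝ (Fin d))
    (hd : 2 ≤ d) (n : ℕ) {L : ℝ} (hL : 0 < L) :
    μ.real {ω | ¬ Optimistic q p (fun i => Y i ω) L n} ≤ (3 * d + 2) * Real.exp (-L) := by
  have hexp := Real.exp_pos (-L)
  by_cases hn : 2 ≤ n
  · obtain ⟨h1, h2, h3, h4, h5⟩ := entropy_sample_facts hY hlaw hind hq_meas hq (by omega : 1 ≤ d)
    have hent := empirical_bernstein_upper h1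
      (by linarith [five_eighths_le_log hd] : 0 < Real.log d) h2 h3 h4 h5 hn hL
    have hcls := measure_not_class_le hY hlaw hind hq_meas hq hn hL
    refine (measureReal_mono ?_).trans ((measureReal_union_le _ _).trans
      ((add_le_add hcls hent).trans (by linarith)))
    intro ω hω
    by_contra h
    simp only [Set.mem_union, Set.mem_iUnion, Set.mem_ofPred_eq, not_or, not_exists, not_not,
      Finset.mem_univ, true_implies] at h
    exact hω fun _ => h
  · have : {ω | ¬ Optimistic q p (fun i => Y i ω) L n} = ∅ := by
      ext ω
      simp [Optimistic, hn]
    rw [this, measureReal_empty]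
    positivity

theorem measure_not_accurate_le [IsProbabilityMeasure μ] (hY : ∀ i, Measurable (Y i))
    (hlaw : ∀ i, μ.map (Y i) = p)
    (hind : iIndepFun Y μ) (hq_meas : Measurable q) (hq : ∀ x, q x ∈ stdSimplex ℝ (Fin d))
    (hd : 2 ≤ d) (n : ℕ) {L : ℝ} (hL : 0 < L) :
    μ.real {ω | ¬ Accurate q p (fun i => Y i ω) L n} ≤ (3 * d + 3) * Real.exp (-L) := by
  have hexp := Real.exp_pos (-L)
  by_cases hn : 2 ≤ n
  · obtain ⟨h1, h2, h3, h4, h5⟩ := entropy_sample_facts hY hlaw hind hq_meas hq (by omega : 1 ≤ d)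
    have hent := empirical_bernstein h1
      (by linarith [five_eighths_le_log hd] : 0 < Real.log d) h2 h3 h4 h5 hn hL
    have hcls := measure_not_class_le hY hlaw hind hq_meas hq hn hL
    refine (measureReal_mono ?_).trans ((measureReal_union_le _ _).trans
      ((add_le_add hcls hent).trans (by linarith)))
    intro ω hω
    by_contra h
    simp only [Set.mem_union, Set.mem_iUnion, Set.mem_ofPred_eq, not_or, not_exists, not_not,
      Finset.mem_univ, true_implies] at h
    exact hω fun _ => h
  · have : {ω | ¬ Accurate q p (fun i => Y i ω) L n} = ∅ := by
      ext ω
      simp [Accurate, hn]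
    rw [this, measureReal_empty]
    positivity

/-- At level L one sample size costs at most δ/T, as 3d + 2 ≤ 4d. At level 3L the cubed probability
beats the G(T - 1) events and leaves δ/T in all, exactly the share unused by the T - 1 sizes. -/
theorem failure_probability_le {T : ℕ} {δ L : ℝ} (hd : 2 ≤ d) (hT : 1 ≤ T) (hGT : G ≤ T)
    (hδ₀ : 0 < δ) (hδ₁ : δ < 1) (hL : Real.exp (-L) = δ / (4 * d * T)) :
    ((T : ℝ) - 1) * ((3 * d + 2) * Real.exp (-L))
      + G * (((T : ℝ) - 1) * ((3 * d + 3) * Real.exp (-(3 * L)))) ≤ δ := by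
  have hdr : (2 : ℝ) ≤ d := by exact_mod_cast hd
  have hTr : (1 : ℝ) ≤ T := by exact_mod_cast hT
  have hGr : (G : ℝ) ≤ T := by exact_mod_cast hGT
  have h3 : Real.exp (-(3 * L)) = (δ / (4 * d * T)) ^ 3 := by
    rw [← hL, ← Real.exp_nat_mul]; congr 1; push_cast; ring
  have hT1 : (0 : ℝ) ≤ T - 1 := by linarith
  have h4 : ((3 : ℝ) * d + 2) * (δ / (4 * d * T)) ≤ δ / T := by
    rw [mul_div_assoc', div_le_div_iff₀ (by positivity) (by positivity)]
    have : 0 ≤ δ * T := by positivity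
    nlinarith
  have h5 : (G : ℝ) * (((T : ℝ) - 1) * ((3 * d + 3) * (δ / (4 * d * T)) ^ 3)) ≤ δ / T := by
    calc _ ≤ (T : ℝ) * (T * ((3 * d + 3 * d) * (δ / (4 * d * T)) ^ 3)) := by
          gcongr <;> linarith
      _ = δ / T * (6 / 64 * (δ ^ 2 / d ^ 2)) := by field_simp; norm_num
      _ ≤ δ / T * 1 := by
          gcongr
          have : δ ^ 2 / (d : ℝ) ^ 2 ≤ 1 := by
            rw [div_le_one (by positivity)]
            nlinarith
          linarith
      _ = δ / T := mul_one _
  rw [hL, h3]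
  calc _ ≤ ((T : ℝ) - 1) * (δ / T) + δ / T := by gcongr
    _ = δ := by field_simp; ring

end Probability

end ISUCB

end

/-! ### The regret theorem -/

theorem theorem4 :
    ∃ (K : ℝ) (k : ℕ) (C : ℕ → ℕ → ℝ), 0 < K ∧
      (∀ d G : ℕ, 1 ≤ d → 1 ≤ G → 0 ≤ C d G ∧ C d G ≤ K * d + Real.log G / 2) ∧
      ∀ (G d b T : ℕ) (_hG : 1 ≤ G) (_hb : 1 ≤ b) (_hT : 1 ≤ T)
        (δ : ℝ) (_hδ₀ : 0 < δ) (_hδ₁ : δ < 1)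
        -- the sample space, the classifier and the generative models
        (𝒳 : Type*) [MeasurableSpace 𝒳]
        (q : 𝒳 → Fin d → ℝ) (_hq_meas : Measurable q) (_hq : ∀ x, q x ∈ stdSimplex ℝ (Fin d))
        (p : Fin G → Measure 𝒳) [∀ g, IsProbabilityMeasure (p g)]
        -- the independent samples: `X g i` is the `i`-th sample generated by the model `g`
        (Ω : Type*) [MeasurableSpace Ω] (μ : Measure Ω) [IsProbabilityMeasure μ]
        (X : Fin G → ℕ → Ω → 𝒳) (_hX_meas : ∀ g i, Measurable (X g i))
        (_hX_law : ∀ g i, μ.map (X g i) = p g)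
        (_hX_indep : iIndepFun (fun s : Fin G × ℕ => X s.1 s.2) μ)
        -- the models picked by the algorithm
        (a : Ω → ℕ → Fin G)
        (_ha : ∀ᵐ ω ∂μ, ISUCB.IsRun q δ b T (fun g i => X g i ω) (a ω)),
        μ {ω | ¬ ISUCB.regret q p T (a ω) ≤
            K * Real.log (4 * d * T / δ) ^ k *
              (G * (ISUCB.gap q p ^ 2)⁻¹ * Real.log d
                + Real.exp (C d G) *
                  ((d * ISUCB.slope q p + Real.log d) * Real.sqrt T + Real.log T))}
          ≤ ENNReal.ofReal δ := by
  refine ⟨256, 1, fun d G => 256 * d + Real.log G / 2, by norm_num,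
    fun d G _ _ => ⟨?_, le_rfl⟩, ?_⟩
  · have : 0 ≤ Real.log G := Real.log_natCast_nonneg G
    positivity
  intro G d b T hG hb hT δ hδ₀ hδ₁ 𝒳 _ q hq_meas hq p _ Ω _ μ _ X hX_meas hX_law hX_indep a ha
  have hTr : (1 : ℝ) ≤ T := by exact_mod_cast hT
  have hd1 : 1 ≤ d := by
    obtain ⟨ω⟩ := μ.nonempty_of_neZero
    by_contra h
    obtain rfl : d = 0 := by omega
    simpa using (hq (X ⟨0, hG⟩ 0 ω)).2
  have hdr : (1 : ℝ) ≤ d := by exact_mod_cast hd1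
  set L := Real.log (4 * d * T / δ) with hL
  have harg : 4 ≤ 4 * d * T / δ := by
    rw [le_div_iff₀ hδ₀]
    nlinarith [mul_le_mul hdr hTr zero_le_one (by linarith)]
  have hexpL : Real.exp (-L) = δ / (4 * d * T) := by
    rw [hL, Real.exp_neg, Real.exp_log (by linarith), inv_div]
  have hL1 : 1 ≤ L := by
    rw [hL, Real.le_log_iff_exp_le (by linarith)]
    linarith [Real.exp_one_lt_d9]
  have hLdef : L = Real.log (4 * d / (δ / T)) := by rw [hL, div_div_eq_mul_div]
  set Bd := 256 * L ^ 1 * (G * (ISUCB.gap q p ^ 2)⁻¹ * Real.log d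
    + Real.exp (256 * d + Real.log G / 2) *
      ((d * ISUCB.slope q p + Real.log d) * Real.sqrt T + Real.log T)) with hBd
  have hempty : (∀ ω, ISUCB.regret q p T (a ω) ≤ Bd) →
      μ {ω | ¬ ISUCB.regret q p T (a ω) ≤ Bd} ≤ ENNReal.ofReal δ := fun h => by
    simp [h]
  -- For d = 1 every score is 1. This case is separate because log d, the range of the entropies, is
  -- then 0.
  rcases hd1.eq_or_lt with hd | hd
  · refine hempty fun ω => ?_
    have : Nonempty (Fin G) := ⟨⟨0, hG⟩⟩
    have h0 : ISUCB.regret q p T (a ω) = 0 := by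
      simp [ISUCB.regret, ISUCB.inceptionScore_eq_one hq_meas hq hd.symm]
    rw [h0, hBd]
    have h1 : 0 ≤ Real.log d := Real.log_natCast_nonneg d
    have h2 : 0 ≤ Real.log T := Real.log_natCast_nonneg T
    have h3 : 0 ≤ ISUCB.slope q p := ISUCB.slope_nonneg
    positivity
  replace hd : 2 ≤ d := hd
  have hbound := ISUCB.bound_le (q := q) (p := p) hd hT hG hL1
  rcases Nat.le_total T G with hTG | hGT
  · exact hempty fun ω =>
      (ISUCB.regret_le_of_le hq_meas hq hd hG hTG hL1 (a ω)).trans hbound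
  have : Nonempty (Fin G) := ⟨⟨0, hG⟩⟩
  obtain ⟨gs, hgs⟩ := exists_eq_ciSup_of_finite (f := fun g => ISUCB.inceptionScore q (p g))
  have hind : ∀ g, iIndepFun (X g) μ := fun g =>
    hX_indep.precomp (g := fun i : ℕ => (g, i)) fun i j h => (Prod.ext_iff.1 h).2
  -- A null event, so classes of zero marginal use up no failure probability.
  have hzero : ∀ᵐ ω ∂μ, ∀ g i j, ISUCB.marginal q (p g) j = 0 → q (X g i ω) j = 0 := by
    simp only [ae_all_iff]
    intro g i j hj
    have h := ISUCB.ae_eq_zero_of_marginal_eq_zero hq_meas hq (p g) hj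
    rw [← hX_law g i] at h
    exact ae_of_ae_map (hX_meas g i).aemeasurable h
  -- The unions run over the deterministic sample sizes b v, so the adaptive choice of the models
  -- does no harm. The count v = 0 is left out because the score is then ∞.
  set E₁ : Set Ω := ⋃ v ∈ Finset.Ico 1 T,
    {ω | ¬ ISUCB.Optimistic q (p gs) (fun i => X gs i ω) L (b * v)} with hE₁
  set E₂ : Set Ω := ⋃ g ∈ (Finset.univ : Finset (Fin G)), ⋃ v ∈ Finset.Ico 1 T,
    {ω | ¬ ISUCB.Accurate q (p g) (fun i => X g i ω) (3 * L) (b * v)} with hE₂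
  have hcard : ((Finset.Ico 1 T).card : ℝ) = T - 1 := by
    rw [Nat.card_Ico, Nat.cast_sub hT, Nat.cast_one]
  have h1 : μ.real E₁ ≤ ((T : ℝ) - 1) * ((3 * d + 2) * Real.exp (-L)) := by
    refine (measureReal_biUnion_finset_le _ _).trans ?_
    refine (Finset.sum_le_card_nsmul _ _ _ fun v _ =>
      ISUCB.measure_not_optimistic_le (hX_meas gs) (hX_law gs) (hind gs) hq_meas hq hd (b * v)
        (by linarith : 0 < L)).trans ?_
    rw [nsmul_eq_mul, hcard]
  have h2 : μ.real E₂ ≤ G * (((T : ℝ) - 1) * ((3 * d + 3) * Real.exp (-(3 * L)))) := by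
    refine (measureReal_biUnion_finset_le _ _).trans ?_
    refine (Finset.sum_le_card_nsmul _ _ (((T : ℝ) - 1) * ((3 * d + 3) * Real.exp (-(3 * L))))
      fun g _ => ?_).trans ?_
    · refine (measureReal_biUnion_finset_le _ _).trans ?_
      refine (Finset.sum_le_card_nsmul _ _ _ fun v _ =>
        ISUCB.measure_not_accurate_le (hX_meas g) (hX_law g) (hind g) hq_meas hq hd (b * v)
          (by linarith : 0 < 3 * L)).trans ?_
      rw [nsmul_eq_mul, hcard]
    · rw [nsmul_eq_mul, Finset.card_univ, Fintype.card_fin]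
  have hE : μ.real (E₁ ∪ E₂) ≤ δ :=
    (measureReal_union_le _ _).trans ((add_le_add h1 h2).trans
      (ISUCB.failure_probability_le hd hT hGT hδ₀ hδ₁ hexpL))
  calc μ {ω | ¬ ISUCB.regret q p T (a ω) ≤ Bd} ≤ μ (E₁ ∪ E₂) := by
        refine measure_mono_ae ?_
        filter_upwards [ha, hzero] with ω hrun hz hω
        by_contra hgood
        replace hgood : ω ∉ E₁ ∪ E₂ := hgood
        simp only [hE₁, hE₂, Set.mem_union, Set.mem_iUnion, Set.mem_ofPred_eq, not_or, not_exists,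
          not_not] at hgood
        exact hω ((ISUCB.regret_le_of_accurate hq_meas hq hd hb hL1 hLdef hrun hgs.symm
          (fun v hv => hgood.1 v hv) (fun g v hv => hgood.2 g (Finset.mem_univ g) v hv) hz).trans
          hbound)
    _ = ENNReal.ofReal (μ.real (E₁ ∪ E₂)) := by rw [ofReal_measureReal]
    _ ≤ ENNReal.ofReal δ := ENNReal.ofReal_le_ofReal hE
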